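/- Let $s(n)$ denote the sum of the proper divisors of the positive integer $n$, $\sigma(n)$ the sum of all its divisors, $\omega(n)$ the number of distinct prime factors of $n$, and $\Omega(n)$ the number of prime factors of $n$ counted with multiplicity. Let $P(n)$ and $P_2(n)$ be the largest and second-largest prime factors of $n$ (counted with multiplicity), with $P(1)=P_2(1)=1$ and $P_2(n)=1$ if $n$ is prime. Put $\log_1 x=\max\{1,\log x\}$ and let $\log_k x$ be the $k$-th iterate of $\log_1$. For real $x>0$ let $\mathcal{E}(x)$ be the set of positive integers $n\le x$ for which at least one of the following conditions fails: A. $P(n)>x^{1/\log_3 x}$; B. $P(n)^2\nmid n$; C. $P_2(n)>x^{1/\log_3 x}$; D. $P_2(n)<\dfrac{xP(n)}{2n}$; E. $P_2(n)^2\nmid n$; F. every prime $q$ dividing $\gcd\big(n/P(n),\,\sigma(n/P(n))\big)$ satisfies $q<\log_2 x$. Then, as $x\to\infty$ through the real numbers, $$\sum_{\substack{n\le x\\ n\notin\mathcal{E}(x)}}\big(\Omega(s(n))-\omega(s(n))\big)^2=o\big(x(\log_2 x)^2\big).$$ -/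

import Mathlib

open scoped ArithmeticFunction.sigma ArithmeticFunction.omega ArithmeticFunction.Omega

namespace Aliquot

/-- `s n`, the sum of the proper divisors of `n`. -/
def s (n : ℕ) : ℕ := ∑ d ∈ n.properDivisors, d

/-- `P n`, the largest prime factor of `n`, with `P 1 = 1`. -/
def P (n : ℕ) : ℕ := if n = 1 then 1 else n.primeFactors.sup id

/-- `P₂ n`, the second-largest prime factor of `n` (prime factors being counted with
multiplicity), that is, the largest prime factor of `n / P n`; so `P₂ n = 1` if `n` is `1`
or a prime. -/
def P₂ (n : ℕ) : ℕ := P (n / P n)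

/-- `logIter k x` is the `k`-th iterate at `x` of the function `max {1, log x}`. -/
noncomputable def logIter (k : ℕ) (x : ℝ) : ℝ := (fun y : ℝ => max 1 (Real.log y))^[k] x

/-- The conjunction of the six conditions that define the non-exceptional `n ≤ x`. -/
structure IsRegular (x : ℝ) (n : ℕ) : Prop where
  condA : x ^ (1 / logIter 3 x) < (P n : ℝ)
  condB : ¬ (P n) ^ 2 ∣ n
  condC : x ^ (1 / logIter 3 x) < (P₂ n : ℝ)
  condD : (P₂ n : ℝ) < x * (P n : ℝ) / (2 * (n : ℝ))
  condE : ¬ (P₂ n) ^ 2 ∣ n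
  condF : ∀ q : ℕ, q.Prime → q ∣ Nat.gcd (n / P n) (σ 1 (n / P n)) → (q : ℝ) < logIter 2 x

open Classical in
/-- The exceptional set: the positive integers `n ≤ x` for which at least one of the six
conditions fails. -/
noncomputable def exceptionalSet (x : ℝ) : Finset ℕ :=
  {n ∈ Finset.Icc 1 ⌊x⌋₊ | ¬ IsRegular x n}

end Aliquot

/-!
The excess `Ω N - ω N` counts the proper prime powers `p ^ k` (`k ≥ 2`) dividing `N`. For `N = s n`
it is controlled with conditions A and B alone: `n = m * r`, where the prime `r = P n` exceeds
`Z = x ^ (1 / log₃ x)` and does not divide `m`, hence `s n = r * s m + σ m` (`s_mul_prime`). For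
fixed `m`, the condition `D ∣ s n` puts `r` into one residue class modulo `D / e`, where `e = gcd D (s m)`
divides `σ m` as well and therefore divides `m`. A bound for primes up to `x / m ≥ Z` in residue
classes thus yields one for the number of `n` with `D ∣ s n` (`card_largePrimeSet_dvd_le`).

The prime powers dividing `s n` are of three kinds.

* Primes `p ≥ Z ^ (1 / 4)`: since `s n ≤ x ^ 2`, at most `8 log₃ x` of them, counted with
  multiplicity, divide `s n`.
* Smaller primes with `p ^ k` above a fixed power of `log x`: then `s n` is divisible by the square
  of a prime power lying between `(log x) ^ 5` and about `Z ^ (1 / 2)` (`exists_primePow_sq_dvd`). By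
  the trivial count of integers in residue classes, this happens for `O (x / (log x) ^ 2)` values of
  `n` (`card_primePowSqSet_exp_le`), for which the bound `Ω (s n) = O (log x)` is enough.
* Prime powers up to a fixed power of `log x`: Cauchy–Schwarz with the weights
  `(k + 1) * p ^ (-k / 2)` reduces their second moment to the counts of `n` with `p ^ k ∣ s n`
  (`sum_sq_card_properPrimePowers_le`). These are bounded by Brun's pure sieve (`brun_sieve`): there
  are `O ((x / (m * q)) * log₂ x * (log₃ x) ^ 2 / log x)` primes up to `x / m` in a residue class
  modulo a small prime power `q`. Since the sum of the weights is `O (log₃ x)`, this part is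
  `O (x * log₂ x * (log₃ x) ^ 4)`.

All three are `o (x * (log₂ x) ^ 2)`.
-/

namespace Aliquot

open Finset

/-! ### Sums and products over primes -/

/-- Chebyshev's argument on a dyadic interval: the product of the primes in `[2 ^ J, 2 ^ (J + 1))`
divides a primorial, so there are at most `2 ^ (J + 2) / J` of them. -/
theorem sum_inv_primes_dyadic (J : ℕ) (hJ : 1 ≤ J) :
    ∑ p ∈ Nat.primesBelow (2 ^ (J + 1)), (1 / p : ℝ) ≤
      ∑ p ∈ Nat.primesBelow (2 ^ J), (1 / p : ℝ) + 4 / J := by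
  set T := (Nat.primesBelow (2 ^ (J + 1))).filter (fun p => ¬ p < 2 ^ J) with hT
  have hsplit := sum_filter_add_sum_filter_not (Nat.primesBelow (2 ^ (J + 1)))
    (fun p => p < 2 ^ J) (fun p => (1 / p : ℝ))
  have hlow : (Nat.primesBelow (2 ^ (J + 1))).filter (fun p => p < 2 ^ J)
      = Nat.primesBelow (2 ^ J) := by
    ext p
    simp only [mem_filter, Nat.mem_primesBelow, pow_succ]
    constructor
    · tauto
    · rintro ⟨h1, h2⟩
      exact ⟨⟨by omega, h2⟩, h1⟩
  rw [hlow] at hsplit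
  rw [← hsplit]
  have hcard : J * #T ≤ 2 ^ (J + 2) := by
    have h1 : (2 ^ J) ^ #T ≤ ∏ p ∈ T, p := by
      rw [← prod_const]
      refine prod_le_prod' fun p hp => ?_
      have := (mem_filter.1 hp).2
      omega
    have h2 : ∏ p ∈ T, p ≤ primorial (2 ^ (J + 1)) := by
      rw [primorial_eq_prod_primesLE]
      refine prod_le_prod_of_subset_of_one_le' ?_ ?_
      · intro p hp
        have := Nat.mem_primesBelow.1 (mem_filter.1 hp).1
        exact Nat.mem_primesLE.2 ⟨this.1.le, this.2⟩
      · intro p hp _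
        exact (Nat.prime_of_mem_primesLE hp).one_le
    have h3 := h1.trans (h2.trans (primorial_le_four_pow _))
    rw [← pow_mul, show (4 : ℕ) = 2 ^ 2 by norm_num, ← pow_mul] at h3
    have h4 := (Nat.pow_le_pow_iff_right (by norm_num : 1 < 2)).1 h3
    calc J * #T ≤ 2 * 2 ^ (J + 1) := h4
      _ = 2 ^ (J + 2) := by ring
  have hb : ∑ p ∈ T, (1 / p : ℝ) ≤ #T * (1 / (2 : ℝ) ^ J) := by
    rw [← nsmul_eq_mul]
    refine sum_le_card_nsmul _ _ _ fun p hp => ?_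
    have : 2 ^ J ≤ p := not_lt.1 (mem_filter.1 hp).2
    have : (2 : ℝ) ^ J ≤ p := by exact_mod_cast this
    gcongr
  have hJ0 : (0 : ℝ) < J := by exact_mod_cast hJ
  have : (#T : ℝ) * (1 / (2 : ℝ) ^ J) ≤ 4 / J := by
    have h : (J : ℝ) * #T ≤ 2 ^ (J + 2) := by exact_mod_cast hcard
    rw [mul_one_div, div_le_div_iff₀ (by positivity) hJ0]
    calc (#T : ℝ) * J = J * #T := by ring
      _ ≤ 2 ^ (J + 2) := h
      _ = 4 * 2 ^ J := by ring
  linarith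

theorem sum_inv_primesBelow_two_pow_le (J : ℕ) (hJ : 1 ≤ J) :
    ∑ p ∈ Nat.primesBelow (2 ^ J), (1 / p : ℝ) ≤ 4 * (1 + Real.log J) := by
  have key : ∀ k : ℕ, ∑ p ∈ Nat.primesBelow (2 ^ (k + 1)), (1 / p : ℝ) ≤ 4 * (harmonic k : ℝ) := by
    intro k
    induction k with
    | zero => simp
    | succ k ih =>
      refine (sum_inv_primes_dyadic (k + 1) (by omega)).trans ?_
      rw [harmonic_succ]
      push_cast at ih ⊢
      rw [div_eq_mul_inv]
      linarith
  obtain ⟨k, rfl⟩ : ∃ k, J = k + 1 := ⟨J - 1, by omega⟩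
  refine (key k).trans ?_
  have h1 := harmonic_le_one_add_log k
  have h2 : Real.log k ≤ Real.log ((k + 1 : ℕ) : ℝ) := by
    rcases Nat.eq_zero_or_pos k with rfl | hk
    · simp
    · exact Real.log_le_log (by exact_mod_cast hk) (by push_cast; linarith)
  linarith

/-- Mertens-type upper bound, without the asymptotic constant. -/
theorem sum_inv_primesBelow_le {n : ℕ} {t : ℝ} (ht : 1 ≤ t) (hn : (n : ℝ) ≤ Real.exp t) :
    ∑ p ∈ Nat.primesBelow (n + 1), (1 / p : ℝ) ≤ 20 * (1 + Real.log t) := by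
  set J := ⌈2 * t⌉₊ with hJ
  have hJ1 : 2 * t ≤ J := Nat.le_ceil _
  have hJ2 : (J : ℝ) < 2 * t + 1 := Nat.ceil_lt_add_one (by linarith)
  have hnJ : n < 2 ^ J := by
    have h1 : Real.exp t < (2 : ℝ) ^ J := by
      rw [← Real.rpow_natCast, Real.rpow_def_of_pos (by norm_num)]
      apply Real.exp_lt_exp.2
      have := Real.log_two_gt_d9
      nlinarith
    exact_mod_cast hn.trans_lt h1
  have hJpos : 1 ≤ J := by
    have : (1 : ℝ) ≤ J := by linarith
    exact_mod_cast this
  have h2 : ∑ p ∈ Nat.primesBelow (n + 1), (1 / p : ℝ) ≤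
      ∑ p ∈ Nat.primesBelow (2 ^ J), (1 / p : ℝ) :=
    sum_le_sum_of_subset_of_nonneg (Nat.primesBelow_mono hnJ) fun _ _ _ => by positivity
  have h3 : Real.log J ≤ 2 + Real.log t := by
    have : Real.log J ≤ Real.log (3 * t) :=
      Real.log_le_log (by linarith) (by linarith)
    rw [Real.log_mul (by norm_num) (by linarith)] at this
    have h4 := Real.log_le_sub_one_of_pos (show (0 : ℝ) < 3 by norm_num)
    linarith
  have h5 := Real.log_nonneg ht
  linarith [sum_inv_primesBelow_two_pow_le J hJpos]

/-- The elementary half of Mertens' product theorem. -/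
theorem prod_one_sub_inv_primesBelow_le {n : ℕ} (hn : 2 ≤ n) :
    ∏ p ∈ Nat.primesBelow n, (1 - 1 / (p : ℝ)) ≤ 1 / Real.log n := by
  have hlog : 0 < Real.log n := Real.log_pos (by exact_mod_cast hn)
  let f : ℕ →* ℝ :=
    { toFun := fun m => ((m : ℝ))⁻¹
      map_one' := by simp
      map_mul' := fun a b => by push_cast; exact mul_inv _ _ }
  have hf : ∀ {p : ℕ}, p.Prime → ‖f p‖ < 1 := by
    intro p hp
    have : (1 : ℝ) < p := by exact_mod_cast hp.one_lt
    simp only [f, MonoidHom.coe_mk, OneHom.coe_mk, norm_inv, Real.norm_natCast]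
    exact inv_lt_one_of_one_lt₀ this
  obtain ⟨hs, hsum⟩ :=
    EulerProduct.summable_and_hasSum_smoothNumbers_prod_primesBelow_geometric hf n
  have hle : Real.log n ≤ ∏ p ∈ Nat.primesBelow n, (1 - f p)⁻¹ := by
    have h1 : Real.log n ≤ (harmonic (n - 1) : ℝ) := by
      have := log_add_one_le_harmonic (n - 1)
      rwa [show n - 1 + 1 = n by omega] at this
    refine h1.trans ?_
    rw [harmonic_eq_sum_Icc]
    push_cast
    let g : ℕ → ↥(Nat.smoothNumbers n) := fun i =>
      if h : 0 < i ∧ i < n then ⟨i, Nat.mem_smoothNumbers_of_lt h.1 h.2⟩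
      else ⟨1, Nat.mem_smoothNumbers_of_lt one_pos (by omega)⟩
    have hg : ∀ i ∈ Icc 1 (n - 1), (g i : ℕ) = i := by
      intro i hi
      rw [mem_Icc] at hi
      simp only [g]
      rw [dif_pos ⟨by omega, by omega⟩]
    have hinj : Set.InjOn g (Icc 1 (n - 1) : Finset ℕ) := by
      intro a ha b hb hab
      rw [← hg a ha, ← hg b hb, hab]
    have h2 : ∑ i ∈ Icc 1 (n - 1), ((i : ℝ))⁻¹ = ∑ m ∈ (Icc 1 (n - 1)).image g, f m := by
      rw [sum_image hinj]
      refine sum_congr rfl fun i hi => ?_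
      simp [f, hg i hi]
    rw [h2]
    exact sum_le_hasSum _ (fun m _ => by simp [f]) hsum
  have heq : ∏ p ∈ Nat.primesBelow n, (1 - f p)⁻¹ =
      (∏ p ∈ Nat.primesBelow n, (1 - 1 / (p : ℝ)))⁻¹ := by
    rw [← prod_inv_distrib]
    refine prod_congr rfl fun p _ => ?_
    simp [f]
  rw [heq] at hle
  rw [← inv_inv (∏ p ∈ Nat.primesBelow n, (1 - 1 / (p : ℝ))), one_div]
  exact inv_anti₀ hlog hle

/-! ### Brun's pure sieve in residue classes -/

theorem abs_card_modEq_sub_le (N r v : ℕ) (hr : 0 < r) :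
    |(#{n ∈ Ioc 0 N | n ≡ v [MOD r]} : ℝ) - N / r| ≤ 1 := by
  have h := Nat.Ioc_filter_modEq_card 0 N hr v
  have hr' : (0 : ℚ) < r := by exact_mod_cast hr
  have hmono : ⌊((0 : ℕ) - v : ℚ) / r⌋ ≤ ⌊((N : ℚ) - v) / r⌋ := by
    apply Int.floor_mono
    gcongr
    positivity
  rw [max_eq_left (sub_nonneg.2 hmono)] at h
  have h1 := Int.floor_le (((N : ℚ) - v) / r)
  have h2 := Int.lt_floor_add_one (((N : ℚ) - v) / r)
  have h3 := Int.floor_le (((0 : ℕ) - v : ℚ) / r)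
  have h4 := Int.lt_floor_add_one (((0 : ℕ) - v : ℚ) / r)
  have h5 : ((#{n ∈ Ioc 0 N | n ≡ v [MOD r]} : ℤ) : ℚ) =
      ⌊((N : ℚ) - v) / r⌋ - ⌊((0 : ℕ) - v : ℚ) / r⌋ := by
    rw [h]; push_cast; ring
  have h6 : ((N : ℚ) - v) / r - ((0 : ℕ) - v : ℚ) / r = N / r := by
    push_cast; ring
  have h7 : |(#{n ∈ Ioc 0 N | n ≡ v [MOD r]} : ℚ) - N / r| ≤ 1 := by
    rw [abs_le]
    push_cast at *
    constructor <;> linarith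
  have h8 : ((|(#{n ∈ Ioc 0 N | n ≡ v [MOD r]} : ℚ) - N / r| : ℚ) : ℝ) ≤ ((1 : ℚ) : ℝ) := by
    exact_mod_cast h7
  push_cast at h8
  exact h8

theorem abs_card_modEq_dvd_sub_le (N q a D : ℕ) (hq : 0 < q) (hD : 0 < D)
    (hcop : q.Coprime D) :
    |(#{n ∈ Ioc 0 N | n ≡ a [MOD q] ∧ D ∣ n} : ℝ) - N / (q * D)| ≤ 1 := by
  obtain ⟨c, hc1, hc2⟩ := Nat.chineseRemainder hcop a 0
  have hset : {n ∈ Ioc 0 N | n ≡ a [MOD q] ∧ D ∣ n} = {n ∈ Ioc 0 N | n ≡ c [MOD q * D]} := by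
    refine filter_congr fun n _ => ?_
    rw [← Nat.modEq_and_modEq_iff_modEq_mul hcop, ← Nat.modEq_zero_iff_dvd]
    exact and_congr ⟨fun h => h.trans hc1.symm, fun h => h.trans hc1⟩
      ⟨fun h => h.trans hc2.symm, fun h => h.trans hc2⟩
  rw [hset]
  have := abs_card_modEq_sub_le N (q * D) c (Nat.mul_pos hq hD)
  push_cast at this
  exact this

/-- Bonferroni's inequality: truncating the alternating sum over subsets after an even number of
steps overestimates the indicator function of the empty set. -/
theorem indicator_empty_le_sum_powerset (T : Finset ℕ) (R : ℕ) :
    (if T = ∅ then (1 : ℝ) else 0) ≤ ∑ A ∈ T.powerset with #A ≤ 2 * R, (-1 : ℝ) ^ #A := by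
  rw [sum_filter, sum_powerset_apply_card (fun j => if j ≤ 2 * R then (-1 : ℝ) ^ j else 0)]
  rcases T.eq_empty_or_nonempty with rfl | hT
  · simp
  rw [if_neg hT.ne_empty]
  obtain ⟨n, hn⟩ : ∃ n, #T = n + 1 := ⟨#T - 1, by have := hT.card_pos; omega⟩
  have h := congrArg (Int.cast : ℤ → ℝ)
    (Int.alternating_sum_range_choose_eq_choose (n := n) (m := 2 * R))
  rw [hn]
  have h2 : ∑ m ∈ range (n + 1 + 1), (n + 1).choose m • (if m ≤ 2 * R then (-1 : ℝ) ^ m else 0)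
      = ∑ m ∈ range (2 * R + 1), (-1 : ℝ) ^ m * (n + 1).choose m := by
    have h3 : ∀ m ∈ range (n + 1 + 1),
        (n + 1).choose m • (if m ≤ 2 * R then (-1 : ℝ) ^ m else 0)
          = if m ≤ 2 * R then (-1 : ℝ) ^ m * (n + 1).choose m else 0 := by
      intro m _
      split_ifs <;> simp [mul_comm]
    rw [sum_congr rfl h3, ← sum_filter]
    refine sum_subset ?_ ?_
    · intro m hm
      rw [mem_filter] at hm
      rw [mem_range]; omega
    · intro m hm hm'
      rw [mem_range] at hm
      rw [mem_filter, mem_range] at hm'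
      rw [Nat.choose_eq_zero_of_lt (by omega)]
      simp
  rw [h2]
  push_cast at h
  rw [h]
  rw [pow_mul]
  norm_num

theorem dvd_iff_prod_dvd_of_primes {A : Finset ℕ} (hA : ∀ p ∈ A, p.Prime) (n : ℕ) :
    (∀ p ∈ A, p ∣ n) ↔ ∏ p ∈ A, p ∣ n := by
  constructor
  · intro h
    exact prod_primes_dvd n (fun p hp => (hA p hp).prime) h
  · intro h p hp
    exact (dvd_prod_of_mem _ hp).trans h

/-- Brun's pure sieve in a residue class: the primes of `S` are sifted out of the integers
`n ≤ N` with `n ≡ a (mod q)`, inclusion–exclusion being truncated after `2 * R` steps. -/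
theorem brun_sieve (N q a R W : ℕ) (hq : 0 < q) (S : Finset ℕ) (hS : ∀ p ∈ S, p.Prime)
    (hcop : ∀ p ∈ S, q.Coprime p) (hW : 1 ≤ W) (hSW : #S ≤ W) :
    (#{n ∈ Ioc 0 N | n ≡ a [MOD q] ∧ ∀ p ∈ S, ¬ p ∣ n} : ℝ) ≤
      (N : ℝ) / q * (∏ p ∈ S, (1 - 1 / (p : ℝ)) + (1 / 4) ^ R * ∏ p ∈ S, (1 + 2 / (p : ℝ)))
        + 3 * (W : ℝ) ^ (2 * R) := by
  classical
  set B := S.powerset.filter (fun A => #A ≤ 2 * R) with hB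
  have hAS : ∀ A ∈ S.powerset, ∀ p ∈ A, p.Prime := fun A hA p hp => hS p (mem_powerset.1 hA hp)
  have hprodpos : ∀ A ∈ S.powerset, 0 < ∏ p ∈ A, p := fun A hA =>
    prod_pos fun p hp => (hAS A hA p hp).pos
  -- Bonferroni's inequality for the set of sifting primes dividing `n`, summed over `n`
  have h1 : (#{n ∈ Ioc 0 N | n ≡ a [MOD q] ∧ ∀ p ∈ S, ¬ p ∣ n} : ℝ) ≤
      ∑ A ∈ B, (-1 : ℝ) ^ #A * #{n ∈ Ioc 0 N | n ≡ a [MOD q] ∧ (∏ p ∈ A, p) ∣ n} := by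
    have e1 : (#{n ∈ Ioc 0 N | n ≡ a [MOD q] ∧ ∀ p ∈ S, ¬ p ∣ n} : ℝ) =
        ∑ n ∈ Ioc 0 N with n ≡ a [MOD q],
          if S.filter (fun p => p ∣ n) = ∅ then (1 : ℝ) else 0 := by
      rw [← sum_filter, filter_filter, sum_const, nsmul_eq_mul, mul_one]
      congr 2
      refine filter_congr fun n _ => ?_
      rw [filter_eq_empty_iff]
    have e2 : ∀ A ∈ B, (-1 : ℝ) ^ #A * #{n ∈ Ioc 0 N | n ≡ a [MOD q] ∧ (∏ p ∈ A, p) ∣ n} =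
        ∑ n ∈ Ioc 0 N with n ≡ a [MOD q], if (∏ p ∈ A, p) ∣ n then (-1 : ℝ) ^ #A else 0 := by
      intro A _
      rw [← sum_filter, filter_filter, sum_const, nsmul_eq_mul, mul_comm]
    rw [e1, sum_congr rfl e2, sum_comm]
    refine sum_le_sum fun n _ => ?_
    refine (indicator_empty_le_sum_powerset _ R).trans (le_of_eq ?_)
    rw [← sum_filter]
    refine sum_congr ?_ fun _ _ => rfl
    ext A
    simp only [mem_filter, mem_powerset, hB]
    constructor
    · rintro ⟨h, h'⟩
      have hAS' : A ⊆ S := h.trans (filter_subset _ _)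
      refine ⟨⟨hAS', h'⟩, ?_⟩
      rw [← dvd_iff_prod_dvd_of_primes (fun p hp => hS p (hAS' hp))]
      exact fun p hp => (mem_filter.1 (h hp)).2
    · rintro ⟨⟨h, h'⟩, h''⟩
      refine ⟨fun p hp => mem_filter.2 ⟨h hp, ?_⟩, h'⟩
      exact (dvd_iff_prod_dvd_of_primes (fun p hp => hS p (h hp)) n).2 h'' p hp
  have h2 : ∑ A ∈ B, (-1 : ℝ) ^ #A * #{n ∈ Ioc 0 N | n ≡ a [MOD q] ∧ (∏ p ∈ A, p) ∣ n} ≤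
      ∑ A ∈ B, ((N : ℝ) / q * ((-1 : ℝ) ^ #A * ∏ p ∈ A, (1 / (p : ℝ))) + 1) := by
    refine sum_le_sum fun A hA => ?_
    have hA' := (mem_filter.1 hA).1
    have hc : q.Coprime (∏ p ∈ A, p) :=
      Nat.Coprime.prod_right fun p hp => hcop p (mem_powerset.1 hA' hp)
    have := abs_card_modEq_dvd_sub_le N q a (∏ p ∈ A, p) hq (hprodpos A hA') hc
    have e : (N : ℝ) / (q * (∏ p ∈ A, p : ℕ)) = N / q * ∏ p ∈ A, (1 / (p : ℝ)) := by
      simp only [one_div, prod_inv_distrib]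
      push_cast
      rw [div_mul_eq_div_div, div_eq_mul_inv ((N : ℝ) / q)]
    rw [e, abs_le] at this
    rcases neg_one_pow_eq_or ℝ #A with h | h <;> rw [h] <;> linarith
  have h3 : ∑ A ∈ B, (-1 : ℝ) ^ #A * ∏ p ∈ A, (1 / (p : ℝ)) ≤
      ∏ p ∈ S, (1 - 1 / (p : ℝ)) + (1 / 4) ^ R * ∏ p ∈ S, (1 + 2 / (p : ℝ)) := by
    have e1 : ∏ p ∈ S, (1 - 1 / (p : ℝ)) =
        ∑ A ∈ S.powerset, (-1 : ℝ) ^ #A * ∏ p ∈ A, (1 / (p : ℝ)) := by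
      have := prod_one_add (f := fun p : ℕ => -(1 / (p : ℝ))) S
      simp only [← sub_eq_add_neg] at this
      rw [this]
      refine sum_congr rfl fun A _ => ?_
      rw [prod_neg]
    have e2 : ∏ p ∈ S, (1 + 2 / (p : ℝ)) =
        ∑ A ∈ S.powerset, (2 : ℝ) ^ #A * ∏ p ∈ A, (1 / (p : ℝ)) := by
      rw [prod_one_add]
      refine sum_congr rfl fun A _ => ?_
      rw [← prod_const, ← prod_mul_distrib]
      refine prod_congr rfl fun p _ => ?_
      ring
    rw [e1, e2, mul_sum, ← sum_filter_add_sum_filter_not S.powerset (fun A => #A ≤ 2 * R)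
      (fun A => (-1 : ℝ) ^ #A * ∏ p ∈ A, (1 / (p : ℝ))), add_assoc, ← hB]
    refine le_add_of_nonneg_right ?_
    -- subsets with more than `2 * R` elements: Rankin's trick
    have h4 : ∑ A ∈ S.powerset with ¬ #A ≤ 2 * R, -((-1 : ℝ) ^ #A * ∏ p ∈ A, (1 / (p : ℝ))) ≤
        ∑ A ∈ S.powerset with ¬ #A ≤ 2 * R,
          (1 / 4 : ℝ) ^ R * ((2 : ℝ) ^ #A * ∏ p ∈ A, (1 / (p : ℝ))) := by
      refine sum_le_sum fun A hA => ?_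
      have hA2 := (mem_filter.1 hA).2
      have hpos : 0 ≤ ∏ p ∈ A, (1 / (p : ℝ)) := prod_nonneg fun _ _ => by positivity
      have : (1 : ℝ) ≤ (1 / 4 : ℝ) ^ R * (2 : ℝ) ^ #A := by
        calc (1 : ℝ) = (1 / 4 : ℝ) ^ R * (2 : ℝ) ^ (2 * R) := by
              rw [pow_mul, ← mul_pow]; norm_num
          _ ≤ (1 / 4 : ℝ) ^ R * (2 : ℝ) ^ #A := by
              gcongr
              · norm_num
              · omega
      have h5 : -((-1 : ℝ) ^ #A * ∏ p ∈ A, (1 / (p : ℝ))) ≤ ∏ p ∈ A, (1 / (p : ℝ)) := by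
        rcases neg_one_pow_eq_or ℝ #A with h | h <;> rw [h] <;> linarith
      rw [← mul_assoc]
      exact h5.trans (le_mul_of_one_le_left hpos this)
    have h6 : ∑ A ∈ S.powerset with ¬ #A ≤ 2 * R,
          (1 / 4 : ℝ) ^ R * ((2 : ℝ) ^ #A * ∏ p ∈ A, (1 / (p : ℝ))) ≤
        ∑ A ∈ S.powerset, (1 / 4 : ℝ) ^ R * ((2 : ℝ) ^ #A * ∏ p ∈ A, (1 / (p : ℝ))) := by
      refine sum_le_sum_of_subset_of_nonneg (filter_subset _ _) fun A _ _ => ?_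
      have hpos : 0 ≤ ∏ p ∈ A, (1 / (p : ℝ)) := prod_nonneg fun _ _ => by positivity
      positivity
    rw [sum_neg_distrib] at h4
    linarith
  have hW0 : (1 : ℝ) ≤ W := by exact_mod_cast hW
  -- the number of subsets with at most `2 * R` elements, again by Rankin's trick
  have h7 : ∑ A ∈ B, (1 : ℝ) ≤ 3 * (W : ℝ) ^ (2 * R) := by
    have h8 : ∑ A ∈ B, (1 : ℝ) ≤ ∑ A ∈ S.powerset, (W : ℝ) ^ (2 * R) * ∏ p ∈ A, (1 / (W : ℝ)) := by
      refine (sum_le_sum fun A hA => ?_).trans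
        (sum_le_sum_of_subset_of_nonneg (filter_subset _ _) fun A _ _ => by positivity)
      rw [prod_const, one_div, inv_pow, ← div_eq_mul_inv, one_le_div (by positivity)]
      exact pow_le_pow_right₀ hW0 (mem_filter.1 hA).2
    rw [← mul_sum, ← prod_one_add, prod_const] at h8
    refine h8.trans ?_
    rw [mul_comm]
    gcongr
    calc (1 + 1 / (W : ℝ)) ^ #S ≤ (1 + 1 / (W : ℝ)) ^ W :=
          pow_le_pow_right₀ (by simp) hSW
      _ ≤ (Real.exp (1 / W)) ^ W := by
          gcongr
          rw [add_comm]; exact Real.add_one_le_exp _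
      _ = Real.exp 1 := by
          rw [← Real.exp_nat_mul]
          congr 1
          field_simp
      _ ≤ 3 := by have := Real.exp_one_lt_d9; linarith
  rw [sum_add_distrib, ← mul_sum] at h2
  have h9 : (N : ℝ) / q * ∑ A ∈ B, (-1 : ℝ) ^ #A * ∏ p ∈ A, (1 / (p : ℝ)) ≤ _ :=
    mul_le_mul_of_nonneg_left h3 (by positivity : (0 : ℝ) ≤ (N : ℝ) / q)
  linarith

/-- An upper bound of Brun–Titchmarsh type for primes in a residue class modulo a prime power. Only
the prime `p` is lost from the sifting set, which costs at most a factor `2` in the main term. -/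
theorem card_primes_modEq_le (N a R W p j : ℕ) (hp : p.Prime) (hW : 2 ≤ W) {t : ℝ} (ht : 1 ≤ t)
    (hWt : (W : ℝ) ≤ Real.exp t) :
    (#{r ∈ Ioc 0 N | r ≡ a [MOD p ^ j] ∧ r.Prime ∧ W ≤ r} : ℝ) ≤
      (N : ℝ) / (p ^ j : ℕ) *
        (2 / Real.log W + (1 / 4) ^ R * Real.exp (40 * (1 + Real.log t)))
        + 3 * (W : ℝ) ^ (2 * R) := by
  set S := (Nat.primesBelow W).erase p with hSdef
  have hS : ∀ r ∈ S, r.Prime := fun r hr => Nat.prime_of_mem_primesBelow (mem_of_mem_erase hr)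
  have hcop : ∀ r ∈ S, (p ^ j).Coprime r := fun r hr =>
    Nat.Coprime.pow_left j ((Nat.coprime_primes hp (hS r hr)).2 (ne_of_mem_erase hr).symm)
  have hSW : #S ≤ W := by
    refine (card_le_card (erase_subset _ _)).trans ?_
    refine (card_filter_le _ _).trans ?_
    simp
  have hb := brun_sieve N (p ^ j) a R W (pow_pos hp.pos j) S hS hcop (by omega) hSW
  have hcard : (#{r ∈ Ioc 0 N | r ≡ a [MOD p ^ j] ∧ r.Prime ∧ W ≤ r} : ℝ) ≤
      #{n ∈ Ioc 0 N | n ≡ a [MOD p ^ j] ∧ ∀ r ∈ S, ¬ r ∣ n} := by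
    refine Nat.cast_le.2 (card_le_card fun r hr => ?_)
    simp only [mem_filter] at hr ⊢
    refine ⟨hr.1, hr.2.1, fun l hl hlr => ?_⟩
    have h1 := (Nat.prime_dvd_prime_iff_eq (hS l hl) hr.2.2.1).1 hlr
    have h2 := Nat.lt_of_mem_primesBelow (mem_of_mem_erase hl)
    omega
  have hnn : ∀ r ∈ Nat.primesBelow W, (1 / 2 : ℝ) ≤ 1 - 1 / (r : ℝ) := by
    intro r hr
    have h2 : (2 : ℝ) ≤ r := by exact_mod_cast (Nat.prime_of_mem_primesBelow hr).two_le
    have : 1 / (r : ℝ) ≤ 1 / 2 := by gcongr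
    linarith
  have hlog : 0 < Real.log W := Real.log_pos (by exact_mod_cast hW)
  have hpr1 : ∏ r ∈ S, (1 - 1 / (r : ℝ)) ≤ 2 / Real.log W := by
    have hM := prod_one_sub_inv_primesBelow_le hW
    have hpos : 0 ≤ ∏ r ∈ S, (1 - 1 / (r : ℝ)) := prod_nonneg fun r hr => by
      linarith [hnn r (mem_of_mem_erase hr)]
    by_cases hpW : p ∈ Nat.primesBelow W
    · rw [← mul_prod_erase _ _ hpW, ← hSdef] at hM
      have := mul_le_mul_of_nonneg_right (hnn p hpW) hpos
      have e : 2 / Real.log W = 2 * (1 / Real.log W) := by ring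
      rw [e]
      linarith
    · rw [hSdef, erase_eq_of_notMem hpW]
      refine hM.trans ?_
      gcongr
      norm_num
  have hpr2 : ∏ r ∈ S, (1 + 2 / (r : ℝ)) ≤ Real.exp (40 * (1 + Real.log t)) := by
    have h1 : ∏ r ∈ S, (1 + 2 / (r : ℝ)) ≤ ∏ r ∈ S, Real.exp (2 * (1 / (r : ℝ))) := by
      refine prod_le_prod (fun r _ => by positivity) fun r _ => ?_
      have := Real.add_one_le_exp (2 * (1 / (r : ℝ)))
      have e : 2 / (r : ℝ) = 2 * (1 / (r : ℝ)) := by ring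
      rw [e]; linarith
    refine h1.trans ?_
    rw [← Real.exp_sum, ← mul_sum]
    apply Real.exp_le_exp.2
    have h2 : ∑ r ∈ S, (1 / (r : ℝ)) ≤ ∑ r ∈ Nat.primesBelow (W + 1), (1 / (r : ℝ)) :=
      sum_le_sum_of_subset_of_nonneg
        ((erase_subset _ _).trans (Nat.primesBelow_mono (Nat.le_succ W)))
        fun _ _ _ => by positivity
    linarith [sum_inv_primesBelow_le ht hWt]
  refine hcard.trans (hb.trans ?_)
  gcongr

/-! ### Divisibility of `s n` by a fixed integer -/

theorem P_prime {n : ℕ} (hn : 2 ≤ n) : (P n).Prime ∧ P n ∣ n := by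
  have hne : n.primeFactors.Nonempty := Nat.nonempty_primeFactors.2 (by omega)
  obtain ⟨p, hp, h⟩ := exists_mem_eq_sup n.primeFactors hne id
  have : P n = p := by
    rw [P, if_neg (by omega), h, id]
  rw [this]
  exact ⟨Nat.prime_of_mem_primeFactors hp, Nat.dvd_of_mem_primeFactors hp⟩

theorem sum_divisors_eq (n : ℕ) : ∑ d ∈ n.divisors, d = s n + n :=
  Nat.sum_divisors_eq_sum_properDivisors_add_self

/-- This is `s (m * p) = p * s m + σ m`, written with `σ m = s m + m`. -/
theorem s_mul_prime {m p : ℕ} (hp : p.Prime) (hpm : ¬ p ∣ m) :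
    s (m * p) = p * s m + (s m + m) := by
  have hc : m.Coprime p := ((Nat.Prime.coprime_iff_not_dvd hp).2 hpm).symm
  have h1 := Nat.Coprime.sum_divisors_mul hc
  rw [sum_divisors_eq, sum_divisors_eq, sum_divisors_eq p] at h1
  have h2 : s p = 1 := by
    rw [s, hp.properDivisors, sum_singleton]
  rw [h2] at h1
  nlinarith

theorem s_le_sq (n : ℕ) : s n ≤ n ^ 2 := by
  have h : ∀ d ∈ n.properDivisors, d ≤ n := fun d hd => (Nat.mem_properDivisors.1 hd).2.le
  refine (sum_le_card_nsmul _ _ _ h).trans ?_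
  rw [smul_eq_mul, pow_two]
  gcongr
  refine (card_le_card Nat.properDivisors_subset_divisors).trans (Nat.card_divisors_le_self n)

theorem s_pos {n : ℕ} (hn : 2 ≤ n) : 0 < s n := by
  have h1 : 1 ∈ n.properDivisors := Nat.mem_properDivisors.2 ⟨one_dvd _, hn⟩
  have h2 := single_le_sum (f := fun d : ℕ => d) (fun _ _ => Nat.zero_le _) h1
  exact h2

theorem sum_div_multiples_le (M e : ℕ) (he : 0 < e) :
    ∑ m ∈ Ioc 0 M with e ∣ m, (e : ℝ) / m ≤ 1 + Real.log M := by
  have hsub : {m ∈ Ioc 0 M | e ∣ m} ⊆ (Ioc 0 M).image (fun k => e * k) := by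
    intro m hm
    rw [mem_filter, mem_Ioc] at hm
    obtain ⟨⟨h1, h2⟩, k, rfl⟩ := hm
    refine mem_image.2 ⟨k, mem_Ioc.2 ⟨Nat.pos_of_mul_pos_left h1, ?_⟩, rfl⟩
    exact (Nat.le_mul_of_pos_left k he).trans h2
  refine (sum_le_sum_of_subset_of_nonneg hsub fun _ _ _ => by positivity).trans ?_
  rw [sum_image (fun a _ b _ hab => Nat.eq_of_mul_eq_mul_left he hab)]
  have h := harmonic_le_one_add_log M
  rw [harmonic_eq_sum_Icc] at h
  push_cast at h
  refine le_trans (le_of_eq ?_) h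
  refine sum_congr rfl fun k _ => ?_
  have : (e : ℝ) ≠ 0 := by exact_mod_cast he.ne'
  push_cast
  rw [div_mul_eq_div_div, div_self this, one_div]

/-- The integers `n ≤ x` whose largest prime factor exceeds `Z` and occurs to the first power. -/
noncomputable def largePrimeSet (x Z : ℝ) : Finset ℕ :=
  {n ∈ Ioc 0 ⌊x⌋₊ | Z < (P n : ℝ) ∧ ¬ P n ^ 2 ∣ n}

theorem mem_largePrimeSet {x Z : ℝ} {n : ℕ} :
    n ∈ largePrimeSet x Z ↔ (0 < n ∧ n ≤ ⌊x⌋₊) ∧ Z < (P n : ℝ) ∧ ¬ P n ^ 2 ∣ n := by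
  rw [largePrimeSet, mem_filter, mem_Ioc]

theorem two_le_of_mem_largePrimeSet {x Z : ℝ} {n : ℕ} (hn : n ∈ largePrimeSet x Z) : 2 ≤ n := by
  rw [mem_largePrimeSet] at hn
  rcases Nat.lt_or_ge n 2 with h | h
  · have h1 : n = 1 := by omega
    subst h1
    exact absurd (by simp [P]) hn.2.2
  · exact h

/-- Transfers a bound for primes in residue classes to a bound for the number of `n` with `D ∣ s n`.
Write `n = m * r` with `r = P n`, so that `D ∣ r * s m + (s m + m)`. Then `e = gcd D (s m)` divides
`m`, and `m` determines `r` modulo `D / e`. The loss of `e` in the modulus is made up for by summing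
over multiples `m` of `e` only. -/
theorem card_largePrimeSet_dvd_le {x Z α β : ℝ} (hx : 1 ≤ x) (hZ : 1 ≤ Z) (hα : 0 ≤ α)
    (hβ : 0 ≤ β) {D : ℕ} (hD : 0 < D)
    (h : ∀ m e a : ℕ, 1 ≤ m → m * Z ≤ x → e ∣ D →
      (#{r ∈ Ioc 0 ⌊x / m⌋₊ | r ≡ a [MOD D / e] ∧ r.Prime ∧ Z < (r : ℝ)} : ℝ) ≤
        α * (x / m) * (e / D) + β) :
    (#{n ∈ largePrimeSet x Z | D ∣ s n} : ℝ) ≤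
      #D.divisors * (α * (x / D) * (1 + Real.log x) + β * (x / Z)) := by
  classical
  set A := {n ∈ largePrimeSet x Z | D ∣ s n} with hA
  set M := ⌊x / Z⌋₊ with hM
  have hx0 : 0 < x := by linarith
  have hZ0 : 0 < Z := by linarith
  have hD0 : (0 : ℝ) < D := by exact_mod_cast hD
  -- the factorization `n = m * r` of an element of the set, with `r = P n`
  have hfac : ∀ n ∈ A, ∀ m, n / P n = m → n = m * P n ∧ (P n).Prime ∧ Z < (P n : ℝ) ∧
      0 < m ∧ (m : ℝ) * P n ≤ x ∧ D ∣ P n * s m + (s m + m) := by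
    intro n hn m hm
    obtain ⟨hn1, hn2⟩ := mem_filter.1 hn
    have hn3 := mem_largePrimeSet.1 hn1
    obtain ⟨hpr, hdvd⟩ := P_prime (two_le_of_mem_largePrimeSet hn1)
    have hnm : n = m * P n := by rw [← hm, Nat.div_mul_cancel hdvd]
    have hm0 : 0 < m := Nat.pos_of_ne_zero fun h0 => by
      rw [h0, zero_mul] at hnm; omega
    have hndvd : ¬ P n ∣ m := by
      rintro ⟨k, hk⟩
      exact hn3.2.2 ⟨k, by rw [pow_two]; nlinarith [hnm, hk]⟩
    refine ⟨hnm, hpr, hn3.2.1, hm0, ?_, ?_⟩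
    · have : (n : ℝ) ≤ x := (Nat.le_floor_iff hx0.le).1 hn3.1.2
      calc (m : ℝ) * P n = ((m * P n : ℕ) : ℝ) := by push_cast; ring
        _ = n := by rw [← hnm]
        _ ≤ x := this
    · rw [← s_mul_prime hpr hndvd, ← hnm]
      exact hn2
  have hmap : ∀ n ∈ A, n / P n ∈ Ioc 0 M := by
    intro n hn
    obtain ⟨h1, h2, h3, h4, h5, h6⟩ := hfac n hn _ rfl
    refine mem_Ioc.2 ⟨h4, Nat.le_floor ?_⟩
    rw [le_div_iff₀ hZ0]
    exact (mul_le_mul_of_nonneg_left h3.le (Nat.cast_nonneg _)).trans h5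
  -- for fixed `m`, the prime `P n` lies in one residue class modulo `D / gcd D (s m)`
  have hfib : ∀ m ∈ Ioc 0 M, (#{n ∈ A | n / P n = m} : ℝ) ≤
      ∑ e ∈ D.divisors, if e ∣ m then α * (x / m) * (e / D) + β else 0 := by
    intro m hm
    have hm0 := (mem_Ioc.1 hm).1
    have hmx : (m : ℝ) * Z ≤ x := by
      rw [← le_div_iff₀ hZ0]
      exact (Nat.le_floor_iff (by positivity)).1 (mem_Ioc.1 hm).2
    have hterm : ∀ e ∈ D.divisors,
        0 ≤ if e ∣ m then α * (x / m) * ((e : ℝ) / D) + β else 0 := by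
      intro e _
      split_ifs <;> positivity
    rcases ({n ∈ A | n / P n = m} : Finset ℕ).eq_empty_or_nonempty with hem | ⟨n₀, hn₀⟩
    · rw [hem]
      simpa using sum_nonneg hterm
    obtain ⟨hn₀A, hn₀m⟩ := mem_filter.1 hn₀
    obtain ⟨-, -, -, -, -, hd₀⟩ := hfac n₀ hn₀A m hn₀m
    set e := Nat.gcd D (s m) with he
    have heD : e ∣ D := Nat.gcd_dvd_left _ _
    have hes : e ∣ s m := Nat.gcd_dvd_right _ _
    have hem : e ∣ m := by
      have h1 : e ∣ P n₀ * s m + (s m + m) := heD.trans hd₀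
      have h2 : e ∣ s m + m := (Nat.dvd_add_right (hes.mul_left _)).1 h1
      exact (Nat.dvd_add_right hes).1 h2
    have hle : (#{n ∈ A | n / P n = m} : ℝ) ≤
        #{r ∈ Ioc 0 ⌊x / m⌋₊ | r ≡ P n₀ [MOD D / e] ∧ r.Prime ∧ Z < (r : ℝ)} := by
      refine Nat.cast_le.2 (card_le_card_of_injOn P ?_ ?_)
      · intro n hn
        obtain ⟨hnA, hnm⟩ := mem_filter.1 hn
        obtain ⟨h1, h2, h3, h4, h5, h6⟩ := hfac n hnA m hnm
        refine mem_filter.2 ⟨mem_Ioc.2 ⟨h2.pos, Nat.le_floor ?_⟩, ?_, h2, h3⟩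
        · rw [le_div_iff₀ (by exact_mod_cast h4), mul_comm]
          exact h5
        · refine Nat.ModEq.cancel_right_div_gcd hD ?_
          refine Nat.ModEq.add_right_cancel' (s m + m) ?_
          exact ((Nat.modEq_zero_iff_dvd).2 h6).trans ((Nat.modEq_zero_iff_dvd).2 hd₀).symm
      · intro n hn n' hn' heq
        obtain ⟨hnA, hnm⟩ := mem_filter.1 hn
        obtain ⟨hnA', hnm'⟩ := mem_filter.1 hn'
        rw [(hfac n hnA m hnm).1, (hfac n' hnA' m hnm').1]
        rw [heq]
    refine (hle.trans (h m e (P n₀) hm0 hmx heD)).trans ?_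
    have := single_le_sum hterm (Nat.mem_divisors.2 ⟨heD, hD.ne'⟩)
    rwa [if_pos hem] at this
  have hcard : (#A : ℝ) = ∑ m ∈ Ioc 0 M, (#{n ∈ A | n / P n = m} : ℝ) := by
    rw [card_eq_sum_card_fiberwise hmap]
    push_cast
    rfl
  rw [hcard]
  refine (sum_le_sum hfib).trans ?_
  rw [sum_comm, ← nsmul_eq_mul]
  refine sum_le_card_nsmul _ _ _ fun e he => ?_
  have he0 : 0 < e := Nat.pos_of_mem_divisors he
  rw [← sum_filter, sum_add_distrib]
  have hMx : (M : ℝ) ≤ x / Z := Nat.floor_le (by positivity)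
  refine add_le_add ?_ ?_
  · have e1 : ∀ m ∈ ({m ∈ Ioc 0 M | e ∣ m} : Finset ℕ),
        α * (x / m) * ((e : ℝ) / D) = α * (x / D) * ((e : ℝ) / m) := by
      intro m _
      ring
    rw [sum_congr rfl e1, ← mul_sum]
    gcongr
    refine (sum_div_multiples_le M e he0).trans ?_
    have : Real.log M ≤ Real.log x := by
      rcases Nat.eq_zero_or_pos M with h0 | h0
      · rw [h0]; simpa using Real.log_nonneg hx
      · refine Real.log_le_log (by exact_mod_cast h0) (hMx.trans ?_)
        exact div_le_self hx0.le hZ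
    linarith
  · rw [sum_const, nsmul_eq_mul, mul_comm]
    gcongr
    refine le_trans ?_ hMx
    have : #{m ∈ Ioc 0 M | e ∣ m} ≤ M := (card_filter_le _ _).trans (by simp)
    exact_mod_cast this

/-! ### The excess of `Ω` over `ω` and proper prime powers -/

theorem cardFactors_eq_sum (N : ℕ) : Ω N = ∑ p ∈ N.primeFactors, N.factorization p := by
  rw [ArithmeticFunction.cardFactors_eq_sum_factorization, Finsupp.sum, Nat.support_factorization]

theorem cardDistinctFactors_le_cardFactors (N : ℕ) : ω N ≤ Ω N := by
  rw [ArithmeticFunction.cardDistinctFactors_apply, ArithmeticFunction.cardFactors_apply]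
  exact (List.dedup_sublist _).length_le

theorem sum_factorization_large_le {N : ℕ} (hN : N ≠ 0) {u L : ℝ} (hu : 1 < u)
    (hL : Real.log N ≤ L) :
    ∑ p ∈ N.primeFactors.filter (fun p : ℕ => u ≤ (p : ℝ)), (N.factorization p : ℝ) ≤
      L / Real.log u := by
  have hlu := Real.log_pos hu
  rw [le_div_iff₀ hlu, sum_mul]
  refine le_trans ?_ hL
  have h1 : Real.log N = ∑ p ∈ N.primeFactors, (N.factorization p : ℝ) * Real.log p := by
    conv_lhs => rw [← Nat.prod_factorization_pow_eq_self hN]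
    rw [Finsupp.prod, Nat.support_factorization]
    push_cast
    rw [Real.log_prod]
    · exact sum_congr rfl fun p _ => Real.log_pow _ _
    · intro p hp
      have := (Nat.prime_of_mem_primeFactors hp).ne_zero
      positivity
  rw [h1]
  refine (sum_le_sum fun p hp => ?_).trans
    (sum_le_sum_of_subset_of_nonneg (filter_subset (fun p : ℕ => u ≤ (p : ℝ)) _) fun p hp _ => ?_)
  · have := (mem_filter.1 hp).2
    gcongr
  · have := Real.log_natCast_nonneg p
    positivity

theorem cardFactors_sub_le_log {N : ℕ} (hN : N ≠ 0) {L : ℝ} (hL : Real.log N ≤ L) :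
    (Ω N : ℝ) - ω N ≤ L / Real.log 2 := by
  have h := sum_factorization_large_le hN (u := 2) (by norm_num) hL
  have hf : N.primeFactors.filter (fun p : ℕ => (2 : ℝ) ≤ (p : ℝ)) = N.primeFactors := by
    refine filter_true_of_mem fun p hp => ?_
    exact_mod_cast (Nat.prime_of_mem_primeFactors hp).two_le
  rw [hf] at h
  rw [cardFactors_eq_sum]
  push_cast
  have : (0 : ℝ) ≤ ω N := Nat.cast_nonneg _
  linarith

/-- The prime powers `p ^ k ≤ Y` with `k ≥ 2`, encoded as pairs `(p, k)`. -/
def properPrimePowers (Y : ℕ) : Finset (ℕ × ℕ) :=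
  {pk ∈ Nat.primesBelow (Y + 1) ×ˢ Finset.range (Y + 1) | 2 ≤ pk.2 ∧ pk.1 ^ pk.2 ≤ Y}

theorem mem_properPrimePowers {Y p k : ℕ} :
    (p, k) ∈ properPrimePowers Y ↔ p.Prime ∧ 2 ≤ k ∧ p ^ k ≤ Y := by
  simp only [properPrimePowers, mem_filter, mem_product, Nat.mem_primesBelow, mem_range]
  constructor
  · tauto
  · rintro ⟨hp, hk, h⟩
    have h1 : p ≤ p ^ k := Nat.le_self_pow (by omega) p
    have h2 : k < p ^ k := Nat.lt_pow_self hp.one_lt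
    exact ⟨⟨⟨by omega, hp⟩, by omega⟩, hk, h⟩

/-- `Ω N - ω N` counts the proper prime powers dividing `N`; those of primes `p ≥ u` are at most
`log N / log u` in number. -/
theorem cardFactors_sub_le {N Y : ℕ} (hN : N ≠ 0) {u L : ℝ} (hu : 1 < u) (hL : Real.log N ≤ L)
    (hY : ∀ p k : ℕ, p.Prime → 2 ≤ k → (p : ℝ) < u → p ^ k ∣ N → p ^ k ≤ Y) :
    (Ω N : ℝ) - ω N ≤ L / Real.log u + #{pk ∈ properPrimePowers Y | pk.1 ^ pk.2 ∣ N} := by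
  have hΩ : (Ω N : ℝ) - ω N = ∑ p ∈ N.primeFactors, ((N.factorization p : ℝ) - 1) := by
    rw [cardFactors_eq_sum, ArithmeticFunction.cardDistinctFactors_apply, sum_sub_distrib,
      sum_const, nsmul_eq_mul, mul_one, ← List.card_toFinset]
    push_cast
    rfl
  have hfp : ∀ p ∈ N.primeFactors, 1 ≤ N.factorization p := fun p hp =>
    (Nat.prime_of_mem_primeFactors hp).factorization_pos_of_dvd hN (Nat.dvd_of_mem_primeFactors hp)
  rw [hΩ, ← sum_filter_add_sum_filter_not N.primeFactors (fun p : ℕ => u ≤ (p : ℝ))]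
  refine add_le_add ?_ ?_
  · refine le_trans (sum_le_sum fun p _ => ?_) (sum_factorization_large_le hN hu hL)
    linarith
  · have e1 : ∑ p ∈ N.primeFactors.filter (fun p : ℕ => ¬ u ≤ (p : ℝ)),
        ((N.factorization p : ℝ) - 1) =
        #((N.primeFactors.filter fun p : ℕ => ¬ u ≤ (p : ℝ)).sigma
          fun p => Icc 2 (N.factorization p)) := by
      rw [card_sigma]
      push_cast
      refine sum_congr rfl fun p hp => ?_
      have := hfp p (mem_filter.1 hp).1
      rw [Nat.card_Icc, show N.factorization p + 1 - 2 = N.factorization p - 1 by omega]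
      push_cast [this]
      ring
    rw [e1]
    refine Nat.cast_le.2 (card_le_card_of_injOn (fun x => (x.1, x.2)) ?_ ?_)
    · rintro ⟨p, k⟩ hx
      simp only [coe_sigma, Set.mem_sigma_iff, mem_coe, mem_filter, mem_Icc] at hx
      have hp := Nat.prime_of_mem_primeFactors hx.1.1
      have hd : p ^ k ∣ N := (hp.pow_dvd_iff_le_factorization hN).2 hx.2.2
      exact mem_filter.2 ⟨mem_properPrimePowers.2
        ⟨hp, hx.2.1, hY p k hp hx.2.1 (not_le.1 hx.1.2) hd⟩, hd⟩
    · rintro ⟨p, k⟩ _ ⟨p', k'⟩ _ h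
      simp only [Prod.mk.injEq] at h
      obtain ⟨rfl, rfl⟩ := h
      rfl

/-- If `p ^ k` is a large proper power dividing `N`, then `N` is divisible by the square of a power
of `p` lying in a bounded range. -/
theorem exists_primePow_sq_dvd {N p k B U : ℕ} (hp : p.Prime) (hk : 2 ≤ k) (hd : p ^ k ∣ N)
    (hB : B ^ 3 < p ^ k) (hB0 : 1 ≤ B) (hU : p * B ≤ U) :
    ∃ b, IsPrimePow b ∧ B < b ∧ b ≤ U ∧ b ^ 2 ∣ N := by
  classical
  have ha : B < p ^ (k / 2) := by
    by_contra hcon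
    have h1 : p ^ k ≤ (p ^ (k / 2)) ^ 3 := by
      rw [← pow_mul]
      exact Nat.pow_le_pow_right hp.pos (by omega)
    have h2 : (p ^ (k / 2)) ^ 3 ≤ B ^ 3 := Nat.pow_le_pow_left (not_lt.1 hcon) 3
    omega
  have hex : ∃ j, B < p ^ j := ⟨_, ha⟩
  set j := Nat.find hex with hj
  have hjs : B < p ^ j := Nat.find_spec hex
  have hjk : j ≤ k / 2 := Nat.find_min' hex ha
  have hj0 : j ≠ 0 := by
    intro h0
    rw [h0, pow_zero] at hjs
    omega
  refine ⟨p ^ j, hp.isPrimePow.pow hj0, hjs, ?_, ?_⟩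
  · obtain ⟨i, hi⟩ := Nat.exists_eq_succ_of_ne_zero hj0
    have h1 : ¬ B < p ^ i := Nat.find_min hex (by omega)
    rw [hi, pow_succ, mul_comm]
    exact (Nat.mul_le_mul_left p (not_lt.1 h1)).trans hU
  · rw [← pow_mul]
    exact (pow_dvd_pow p (by omega)).trans hd

theorem card_divisors_sq_le {b : ℕ} (hb : IsPrimePow b) :
    (#(b ^ 2).divisors : ℝ) ≤ 5 * Real.log b := by
  obtain ⟨p, j, hp, hj, rfl⟩ := (isPrimePow_nat_iff _).1 hb
  rw [← pow_mul, Nat.divisors_prime_pow hp, card_map, card_range]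
  push_cast
  rw [Real.log_pow]
  have h2 : Real.log 2 ≤ Real.log p :=
    Real.log_le_log (by norm_num) (by exact_mod_cast hp.two_le)
  have h3 := Real.log_two_gt_d9
  have hj' : (1 : ℝ) ≤ j := by exact_mod_cast hj
  nlinarith

/-- The weights `(k + 1) * p ^ (-k / 2)` are dominated by `1 / p`, uniformly after summation over
`k ≥ 2`. -/
theorem exists_sum_properPrimePowers_le : ∃ C : ℝ, 0 < C ∧ ∀ Y : ℕ,
    ∑ pk ∈ properPrimePowers Y, ((pk.2 : ℝ) + 1) * (1 / √(pk.1 : ℝ)) ^ pk.2 ≤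
      C * ∑ p ∈ Nat.primesBelow (Y + 1), (1 / p : ℝ) := by
  have hr0 : (0 : ℝ) < 1 / √2 := by positivity
  have hr1 : 1 / √(2 : ℝ) < 1 := by
    rw [div_lt_one (by positivity)]
    exact Real.lt_sqrt_of_sq_lt (by norm_num)
  have hnr : ‖1 / √(2 : ℝ)‖ < 1 := by
    rwa [Real.norm_of_nonneg hr0.le]
  have hsum : Summable fun k : ℕ => ((k : ℝ) + 1) * (1 / √(2 : ℝ)) ^ k := by
    have h1 := summable_pow_mul_geometric_of_norm_lt_one 1 hnr
    have h2 := summable_geometric_of_norm_lt_one hnr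
    refine (h1.add h2).congr fun k => ?_
    ring
  have hnn : ∀ k : ℕ, 0 ≤ ((k : ℝ) + 1) * (1 / √(2 : ℝ)) ^ k := fun k => by positivity
  have hT : 1 ≤ ∑' k : ℕ, ((k : ℝ) + 1) * (1 / √(2 : ℝ)) ^ k := by
    have := hsum.le_tsum 0 fun k _ => hnn k
    simpa using this
  refine ⟨2 * ∑' k : ℕ, ((k : ℝ) + 1) * (1 / √(2 : ℝ)) ^ k, by linarith, fun Y => ?_⟩
  have hterm : ∀ pk ∈ properPrimePowers Y,
      ((pk.2 : ℝ) + 1) * (1 / √(pk.1 : ℝ)) ^ pk.2 ≤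
        (1 / (pk.1 : ℝ)) * (2 * (((pk.2 : ℝ) + 1) * (1 / √(2 : ℝ)) ^ pk.2)) := by
    rintro ⟨p, k⟩ hpk
    obtain ⟨hp, hk, -⟩ := mem_properPrimePowers.1 hpk
    obtain ⟨i, rfl⟩ : ∃ i, k = 2 + i := ⟨k - 2, by omega⟩
    have hp2 : (2 : ℝ) ≤ p := by exact_mod_cast hp.two_le
    have e1 : (1 / √(p : ℝ)) ^ 2 = 1 / p := by
      rw [div_pow, Real.sq_sqrt (by positivity), one_pow]
    have e2 : (1 / √(2 : ℝ)) ^ 2 = 1 / 2 := by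
      rw [div_pow, Real.sq_sqrt (by positivity), one_pow]
    have h1 : (1 / √(p : ℝ)) ^ i ≤ (1 / √(2 : ℝ)) ^ i := by gcongr
    simp only [pow_add, e1, e2]
    have h2 : (0 : ℝ) ≤ (((2 + i : ℕ) : ℝ) + 1) * (1 / p) := by positivity
    calc (((2 + i : ℕ) : ℝ) + 1) * (1 / p * (1 / √(p : ℝ)) ^ i)
        = (((2 + i : ℕ) : ℝ) + 1) * (1 / p) * (1 / √(p : ℝ)) ^ i := by ring
      _ ≤ (((2 + i : ℕ) : ℝ) + 1) * (1 / p) * (1 / √(2 : ℝ)) ^ i :=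
          mul_le_mul_of_nonneg_left h1 h2
      _ = _ := by ring
  refine (sum_le_sum hterm).trans ?_
  refine (sum_le_sum_of_subset_of_nonneg (filter_subset _ _) fun _ _ _ => by positivity).trans ?_
  rw [sum_product, mul_comm, sum_mul]
  refine sum_le_sum fun p _ => ?_
  dsimp only
  rw [← mul_sum, ← mul_sum]
  gcongr
  exact hsum.sum_le_tsum _ fun k _ => hnn k

/-! ### Moments over integers with a large simple prime factor -/

open Classical in
/-- The elements `n` of `largePrimeSet x Z` for which `s n` is divisible by the square of a prime
power in `(B, U]`. -/
noncomputable def primePowSqSet (x Z : ℝ) (B U : ℕ) : Finset ℕ :=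
  {n ∈ largePrimeSet x Z | ∃ b, IsPrimePow b ∧ B < b ∧ b ≤ U ∧ b ^ 2 ∣ s n}

/-- Here the trivial bound for integers in a residue class is enough. It loses a factor `log x`
against the bound for primes, which is harmless when `B` is a power of `log x`. -/
theorem card_primePowSqSet_le {x Z : ℝ} (hx : 1 ≤ x) (hZ : 1 ≤ Z) {B U : ℕ}
    (hB : 1 ≤ B) (hU : (U : ℝ) ≤ x) :
    (#(primePowSqSet x Z B U) : ℝ) ≤
      5 * Real.log x * (x / B * (1 + Real.log x) + U * (x / Z)) := by
  classical
  have hx0 : 0 < x := by linarith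
  have hlx := Real.log_nonneg hx
  set T := {b ∈ Ioc B U | IsPrimePow b} with hT
  have hsub : primePowSqSet x Z B U ⊆
      T.biUnion fun b => {n ∈ largePrimeSet x Z | b ^ 2 ∣ s n} := by
    intro n hn
    obtain ⟨h1, b, hb, h2, h3, h4⟩ := mem_filter.1 hn
    exact mem_biUnion.2 ⟨b, mem_filter.2 ⟨mem_Ioc.2 ⟨h2, h3⟩, hb⟩, mem_filter.2 ⟨h1, h4⟩⟩
  have h1 : (#(primePowSqSet x Z B U) : ℝ) ≤
      ∑ b ∈ T, (#{n ∈ largePrimeSet x Z | b ^ 2 ∣ s n} : ℝ) := by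
    exact_mod_cast (card_le_card hsub).trans card_biUnion_le
  have h2 : ∀ b ∈ T, (#{n ∈ largePrimeSet x Z | b ^ 2 ∣ s n} : ℝ) ≤
      5 * Real.log x * (x * (1 + Real.log x) * ((b : ℝ) ^ 2)⁻¹ + x / Z) := by
    intro b hb
    obtain ⟨hb1, hb2⟩ := mem_filter.1 hb
    have hb0 : 0 < b := hb2.pos
    have hbx : (b : ℝ) ≤ x := le_trans (by exact_mod_cast (mem_Ioc.1 hb1).2) hU
    have h3 := card_largePrimeSet_dvd_le hx hZ zero_le_one zero_le_one (D := b ^ 2)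
      (by positivity) (fun m e a hm hmx he => by
        obtain ⟨c, hc⟩ := he
        have hbb : 0 < b ^ 2 := by positivity
        have he0 : 0 < e := Nat.pos_of_mul_pos_right (hc ▸ hbb)
        have hc0 : 0 < c := Nat.pos_of_mul_pos_left (hc ▸ hbb)
        have h4 : (#{r ∈ Ioc 0 ⌊x / m⌋₊ | r ≡ a [MOD b ^ 2 / e] ∧ r.Prime ∧ Z < (r : ℝ)} : ℝ) ≤
            #{r ∈ Ioc 0 ⌊x / m⌋₊ | r ≡ a [MOD b ^ 2 / e]} := by
          refine Nat.cast_le.2 (card_le_card fun r hr => ?_)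
          simp only [mem_filter] at hr ⊢
          exact ⟨hr.1, hr.2.1⟩
        rw [hc, Nat.mul_div_cancel_left c he0] at h4 ⊢
        have h5 := (abs_le.1 (abs_card_modEq_sub_le ⌊x / m⌋₊ c a hc0)).2
        have h6 : (⌊x / m⌋₊ : ℝ) ≤ x / m := Nat.floor_le (by positivity)
        have h7 : (⌊x / m⌋₊ : ℝ) / c ≤ x / m / c := by gcongr
        have h8 : (1 : ℝ) * (x / m) * ((e : ℝ) / (e * c : ℕ)) = x / m / c := by
          push_cast
          field_simp
        rw [h8]
        linarith)
    refine h3.trans ?_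
    have h9 : Real.log b ≤ Real.log x := Real.log_le_log (by exact_mod_cast hb0) hbx
    have h10 : (#(b ^ 2).divisors : ℝ) ≤ 5 * Real.log x := by
      linarith [card_divisors_sq_le hb2]
    have h11 : 1 * (x / (b ^ 2 : ℕ)) * (1 + Real.log x) + 1 * (x / Z) =
        x * (1 + Real.log x) * ((b : ℝ) ^ 2)⁻¹ + x / Z := by
      push_cast
      ring
    rw [h11]
    gcongr
  refine h1.trans ((sum_le_sum h2).trans ?_)
  rw [← mul_sum]
  gcongr
  have hnn : 0 ≤ x / Z := by positivity
  refine (sum_le_sum_of_subset_of_nonneg (filter_subset _ _) fun b _ _ => by positivity).trans ?_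
  rw [sum_add_distrib, ← mul_sum, sum_const, nsmul_eq_mul, Nat.card_Ioc]
  have h12 : ∑ b ∈ Ioc B U, ((b : ℝ) ^ 2)⁻¹ ≤ (B : ℝ)⁻¹ := by
    rcases le_total B U with h | h
    · refine (sum_Ioc_inv_sq_le_sub (by omega) h).trans ?_
      have : (0 : ℝ) ≤ (U : ℝ)⁻¹ := by positivity
      linarith
    · rw [Ioc_eq_empty (by omega)]
      simp
  have h13 : ((U - B : ℕ) : ℝ) ≤ U := by exact_mod_cast Nat.sub_le U B
  have h14 : x / B * (1 + Real.log x) = x * (1 + Real.log x) * (B : ℝ)⁻¹ := by ring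
  rw [h14]
  gcongr

/-- Cauchy–Schwarz with weights reduces the second moment of the number of proper prime powers
dividing `f n` to first moments. -/
theorem sum_sq_card_properPrimePowers_le (A : Finset ℕ) (f : ℕ → ℕ) {Y : ℕ} {G : ℝ}
    (h : ∀ p k : ℕ, (p, k) ∈ properPrimePowers Y →
      (#{n ∈ A | p ^ k ∣ f n} : ℝ) ≤ ((k : ℝ) + 1) * (G / (p : ℝ) ^ k)) (hG : 0 ≤ G) :
    ∑ n ∈ A, (#{pk ∈ properPrimePowers Y | pk.1 ^ pk.2 ∣ f n} : ℝ) ^ 2 ≤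
      G * (∑ pk ∈ properPrimePowers Y, ((pk.2 : ℝ) + 1) * (1 / √(pk.1 : ℝ)) ^ pk.2) ^ 2 := by
  set K := properPrimePowers Y
  set w : ℕ × ℕ → ℝ := fun pk => ((pk.2 : ℝ) + 1) * (1 / √(pk.1 : ℝ)) ^ pk.2 with hw
  have hppos : ∀ pk ∈ K, (0 : ℝ) < pk.1 := fun pk hpk => by
    exact_mod_cast (mem_properPrimePowers.1 hpk).1.pos
  have hwpos : ∀ pk ∈ K, 0 < w pk := fun pk hpk => by
    have := hppos pk hpk
    simp only [hw]
    positivity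
  have hCS : ∀ n ∈ A, (#{pk ∈ K | pk.1 ^ pk.2 ∣ f n} : ℝ) ^ 2 ≤
      (∑ pk ∈ K, w pk) * ∑ pk ∈ K, (w pk)⁻¹ * if pk.1 ^ pk.2 ∣ f n then 1 else 0 := by
    intro n _
    have e : (#{pk ∈ K | pk.1 ^ pk.2 ∣ f n} : ℝ) =
        ∑ pk ∈ K, if pk.1 ^ pk.2 ∣ f n then (1 : ℝ) else 0 := by
      rw [← sum_filter, sum_const, nsmul_eq_mul, mul_one]
    rw [e]
    refine sum_sq_le_sum_mul_sum_of_sq_le_mul _ (fun pk hpk => (hwpos pk hpk).le) ?_ ?_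
    · intro pk hpk
      have := hwpos pk hpk
      split_ifs <;> positivity
    · intro pk hpk
      have := (hwpos pk hpk).ne'
      split_ifs <;> simp [this]
  refine (sum_le_sum hCS).trans ?_
  rw [← mul_sum, sum_comm]
  have hin : ∀ pk ∈ K, ∑ n ∈ A, (w pk)⁻¹ * (if pk.1 ^ pk.2 ∣ f n then (1 : ℝ) else 0) ≤
      G * w pk := by
    rintro ⟨p, k⟩ hpk
    have hp0 : (0 : ℝ) < p := hppos _ hpk
    have hw0 := hwpos _ hpk
    rw [← mul_sum, ← sum_filter, sum_const, nsmul_eq_mul, mul_one, inv_mul_le_iff₀ hw0]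
    refine (h p k hpk).trans ?_
    have e1 : (1 / √(p : ℝ)) ^ k * (1 / √(p : ℝ)) ^ k = 1 / (p : ℝ) ^ k := by
      rw [← mul_pow, div_mul_div_comm, Real.mul_self_sqrt hp0.le, one_mul, one_div_pow]
    have e2 : w (p, k) * (G * w (p, k)) =
        ((k : ℝ) + 1) * ((k : ℝ) + 1) * (G * (1 / (p : ℝ) ^ k)) := by
      rw [← e1]
      simp only [hw]
      ring
    rw [e2, mul_one_div, mul_assoc]
    have : (0 : ℝ) ≤ ((k : ℝ) + 1) * (G / (p : ℝ) ^ k) := by positivity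
    refine le_mul_of_one_le_left this ?_
    have : (0 : ℝ) ≤ k := Nat.cast_nonneg k
    linarith
  have hsw : 0 ≤ ∑ pk ∈ K, w pk := sum_nonneg fun pk hpk => (hwpos pk hpk).le
  calc (∑ pk ∈ K, w pk) *
        ∑ pk ∈ K, ∑ n ∈ A, (w pk)⁻¹ * (if pk.1 ^ pk.2 ∣ f n then (1 : ℝ) else 0)
      ≤ (∑ pk ∈ K, w pk) * ∑ pk ∈ K, G * w pk :=
        mul_le_mul_of_nonneg_left (sum_le_sum hin) hsw
    _ = G * (∑ pk ∈ K, w pk) ^ 2 := by rw [← mul_sum]; ring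

/-- The three terms bound, in this order, the contribution of the primes `p ≥ u`, that of the proper
prime powers `p ^ k ≤ B ^ 3`, and that of the `n` in `primePowSqSet`, where only the trivial bound
`Ω (s n) ≤ log (s n) / log 2` is used. -/
theorem sum_sq_cardFactors_sub_le {x Z u G : ℝ} {B U : ℕ} (hx : 1 ≤ x) (hu : 1 < u)
    (hB : 1 ≤ B) (hU : u * B ≤ U) (hG : 0 ≤ G)
    (h : ∀ p k : ℕ, (p, k) ∈ properPrimePowers (B ^ 3) →
      (#{n ∈ largePrimeSet x Z | p ^ k ∣ s n} : ℝ) ≤ ((k : ℝ) + 1) * (G / (p : ℝ) ^ k)) :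
    ∑ n ∈ largePrimeSet x Z, ((Ω (s n) : ℝ) - ω (s n)) ^ 2 ≤
      x * (2 * (2 * Real.log x / Real.log u) ^ 2) +
      2 * (G * (∑ pk ∈ properPrimePowers (B ^ 3),
        ((pk.2 : ℝ) + 1) * (1 / √(pk.1 : ℝ)) ^ pk.2) ^ 2) +
      (#(primePowSqSet x Z B U) : ℝ) *
        (2 * Real.log x / Real.log 2) ^ 2 := by
  classical
  set A := largePrimeSet x Z with hA
  set L := 2 * Real.log x with hL
  have hpt : ∀ n ∈ A, ((Ω (s n) : ℝ) - ω (s n)) ^ 2 ≤ 2 * (L / Real.log u) ^ 2 +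
      2 * (#{pk ∈ properPrimePowers (B ^ 3) | pk.1 ^ pk.2 ∣ s n} : ℝ) ^ 2 +
      if ∃ b, IsPrimePow b ∧ B < b ∧ b ≤ U ∧ b ^ 2 ∣ s n then (L / Real.log 2) ^ 2 else 0 := by
    intro n hn
    have hn2 := two_le_of_mem_largePrimeSet hn
    have hs0 : s n ≠ 0 := (s_pos hn2).ne'
    have hnx : (n : ℝ) ≤ x :=
      (Nat.le_floor_iff (by linarith)).1 (mem_largePrimeSet.1 hn).1.2
    have hlog : Real.log (s n) ≤ L := by
      have h1 : ((s n : ℕ) : ℝ) ≤ x ^ 2 := by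
        calc ((s n : ℕ) : ℝ) ≤ ((n ^ 2 : ℕ) : ℝ) := by exact_mod_cast s_le_sq n
          _ ≤ x ^ 2 := by push_cast; gcongr
      have h2 := Real.log_le_log (by exact_mod_cast s_pos hn2) h1
      rwa [Real.log_pow] at h2
    have h0 : 0 ≤ (Ω (s n) : ℝ) - ω (s n) :=
      sub_nonneg.2 (by exact_mod_cast cardDistinctFactors_le_cardFactors (s n))
    split_ifs with hex
    · have h1 := pow_le_pow_left₀ h0 (cardFactors_sub_le_log hs0 hlog) 2
      have h2 : 0 ≤ 2 * (L / Real.log u) ^ 2 := by positivity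
      have h3 : 0 ≤ 2 * (#{pk ∈ properPrimePowers (B ^ 3) | pk.1 ^ pk.2 ∣ s n} : ℝ) ^ 2 := by
        positivity
      linarith
    · have h1 := cardFactors_sub_le (Y := B ^ 3) hs0 hu hlog (fun p k hp hk hpu hd => by
        by_contra hcon
        refine hex (exists_primePow_sq_dvd hp hk hd (not_le.1 hcon) hB ?_)
        have : (p : ℝ) * B ≤ U := le_trans (by gcongr) hU
        exact_mod_cast this)
      have h2 := pow_le_pow_left₀ h0 h1 2
      nlinarith [sq_nonneg (L / Real.log u -
        (#{pk ∈ properPrimePowers (B ^ 3) | pk.1 ^ pk.2 ∣ s n} : ℝ))]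
  refine (sum_le_sum hpt).trans ?_
  rw [sum_add_distrib, sum_add_distrib, sum_const, ← mul_sum, ← sum_filter, sum_const,
    nsmul_eq_mul, nsmul_eq_mul]
  have hcard : (#A : ℝ) ≤ x := by
    have h1 : #A ≤ ⌊x⌋₊ := (card_filter_le _ _).trans (by simp)
    exact (Nat.le_floor_iff (by linarith)).1 h1
  have hmain := sum_sq_card_properPrimePowers_le A s h hG
  refine add_le_add (add_le_add ?_ ?_) (le_of_eq ?_)
  · gcongr
  · linarith
  · rw [primePowSqSet]

/-- The sieve bound for the number of `n` with `p ^ k ∣ s n`. -/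
theorem card_largePrimeSet_primePow_le {x Z H t : ℝ} {W R Y p k : ℕ} (hx : 1 ≤ x) (hZ : 1 ≤ Z)
    (hp : p.Prime) (hkY : p ^ k ≤ Y) (ht : 1 ≤ t) (hW : 2 ≤ W) (hWt : (W : ℝ) ≤ Real.exp t)
    (hWZ : (W : ℝ) ≤ Z)
    (hH : 2 / Real.log W + (1 / 4) ^ R * Real.exp (40 * (1 + Real.log t)) +
      3 * (W : ℝ) ^ (2 * R) * Y / Z ≤ H) :
    (#{n ∈ largePrimeSet x Z | p ^ k ∣ s n} : ℝ) ≤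
      ((k : ℝ) + 1) * (H * x * (1 + Real.log x) / (p : ℝ) ^ k) := by
  have hZ0 : 0 < Z := by linarith
  have hlog : 0 < Real.log W := Real.log_pos (by exact_mod_cast hW)
  have hH0 : 0 ≤ H := le_trans (by positivity) hH
  have h := card_largePrimeSet_dvd_le hx hZ hH0 le_rfl (D := p ^ k) (pow_pos hp.pos k)
    (fun m e a hm hmx he => by
      obtain ⟨i, hi, rfl⟩ := (Nat.dvd_prime_pow hp).1 he
      have hm0 : (0 : ℝ) < m := by exact_mod_cast hm
      have hp0 : (0 : ℝ) < p := by exact_mod_cast hp.pos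
      have hpp : (0 : ℝ) < (p ^ (k - i) : ℕ) := by exact_mod_cast pow_pos hp.pos _
      rw [Nat.pow_div hi hp.pos]
      have h1 : (#{r ∈ Ioc 0 ⌊x / m⌋₊ | r ≡ a [MOD p ^ (k - i)] ∧ r.Prime ∧ Z < (r : ℝ)} : ℝ) ≤
          #{r ∈ Ioc 0 ⌊x / m⌋₊ | r ≡ a [MOD p ^ (k - i)] ∧ r.Prime ∧ W ≤ r} := by
        refine Nat.cast_le.2 (card_le_card fun r hr => ?_)
        simp only [mem_filter] at hr ⊢
        refine ⟨hr.1, hr.2.1, hr.2.2.1, ?_⟩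
        exact_mod_cast hWZ.trans hr.2.2.2.le
      have h2 := card_primes_modEq_le ⌊x / m⌋₊ a R W p (k - i) hp hW ht hWt
      have h3 : (⌊x / m⌋₊ : ℝ) ≤ x / m := Nat.floor_le (by positivity)
      have h4 : ((p ^ i : ℕ) : ℝ) / (p ^ k : ℕ) = 1 / (p ^ (k - i) : ℕ) := by
        have : p ^ k = p ^ i * p ^ (k - i) := by rw [← pow_add, Nat.add_sub_cancel' hi]
        rw [this]
        push_cast
        field_simp
      have h5 : Z ≤ x / m := by
        rw [le_div_iff₀ hm0, mul_comm]; exact hmx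
      have h6 : ((p ^ (k - i) : ℕ) : ℝ) ≤ Y := by
        exact_mod_cast (Nat.pow_le_pow_right hp.pos (Nat.sub_le k i)).trans hkY
      have h7 : 3 * (W : ℝ) ^ (2 * R) ≤
          x / m / (p ^ (k - i) : ℕ) * (3 * (W : ℝ) ^ (2 * R) * Y / Z) := by
        have h8 : 1 ≤ x / m / (p ^ (k - i) : ℕ) * (Y / Z) := by
          rw [div_mul_div_comm, one_le_div (by positivity)]
          calc ((p ^ (k - i) : ℕ) : ℝ) * Z ≤ Y * (x / m) := by gcongr
            _ = x / m * Y := by ring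
        calc 3 * (W : ℝ) ^ (2 * R) = 3 * (W : ℝ) ^ (2 * R) * 1 := by ring
          _ ≤ 3 * (W : ℝ) ^ (2 * R) * (x / m / (p ^ (k - i) : ℕ) * (Y / Z)) := by gcongr
          _ = _ := by ring
      have h9 : (⌊x / m⌋₊ : ℝ) / (p ^ (k - i) : ℕ) *
          (2 / Real.log W + (1 / 4) ^ R * Real.exp (40 * (1 + Real.log t))) ≤
          x / m / (p ^ (k - i) : ℕ) *
          (2 / Real.log W + (1 / 4) ^ R * Real.exp (40 * (1 + Real.log t))) := by
        gcongr
      have h10 := mul_le_mul_of_nonneg_left hH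
        (show 0 ≤ x / m / (p ^ (k - i) : ℕ) by positivity)
      rw [h4, add_zero]
      have h11 : H * (x / m) * (1 / (p ^ (k - i) : ℕ)) = x / m / (p ^ (k - i) : ℕ) * H := by ring
      rw [h11]
      rw [mul_add] at h10
      linarith)
  rw [Nat.divisors_prime_pow hp, card_map, card_range] at h
  refine h.trans (le_of_eq ?_)
  push_cast
  ring

/-! ### The second moment as `x` tends to infinity -/

theorem mul_sq_le_exp {v : ℝ} (hv : 328 ≤ v) : 1000 * v ^ 2 ≤ Real.exp v := by
  have h := Real.pow_div_factorial_le_exp v (by linarith) 4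
  norm_num [Nat.factorial] at h
  have h1 : 24000 * v ^ 2 ≤ v ^ 4 := by
    have : (24000 : ℝ) ≤ v ^ 2 := by nlinarith
    calc 24000 * v ^ 2 ≤ v ^ 2 * v ^ 2 := by gcongr
      _ = v ^ 4 := by ring
  linarith

/-- A choice of sifting level `W` and truncation `R` in Brun's sieve for which all the error terms
are of smaller order than the main term. -/
theorem exists_sieve_parameters {a b c : ℝ} (hc : 328 ≤ c) (hcb : Real.exp c = b)
    (hba : Real.exp b = a) {Y : ℕ} (hY : (Y : ℝ) ≤ Real.exp (18 * b)) :
    ∃ (W R : ℕ) (t : ℝ), 1 ≤ t ∧ 2 ≤ W ∧ (W : ℝ) ≤ Real.exp t ∧ (W : ℝ) ≤ Real.exp (a / c) ∧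
      2 / Real.log W + (1 / 4) ^ R * Real.exp (40 * (1 + Real.log t)) +
        3 * (W : ℝ) ^ (2 * R) * Y / Real.exp (a / c) ≤ 6 * (b * c ^ 2) / a := by
  have hc0 : 0 < c := by linarith
  have hb : 1000 * c ^ 2 ≤ b := hcb ▸ mul_sq_le_exp hc
  have hb1 : 1000 ≤ b := by nlinarith
  have hb0 : 0 < b := by linarith
  have ha : 1000 * b ^ 2 ≤ a := hba ▸ mul_sq_le_exp (by linarith)
  have ha0 : 0 < a := hba ▸ Real.exp_pos b
  have hc2 : 1 ≤ c ^ 2 := one_le_pow₀ (by linarith)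
  have hcb' : c ≤ b := by nlinarith
  have hbc2 : 1 ≤ b * c ^ 2 := one_le_mul_of_one_le_of_one_le (by linarith) hc2
  have habc : 300 * b ≤ a / c := by
    rw [le_div_iff₀ hc0]
    nlinarith
  have hla : Real.log a = b := by rw [← hba, Real.log_exp]
  set t := a / (b * c ^ 2) with htdef
  have ht2 : 1000 ≤ t := by
    rw [htdef, le_div_iff₀ (by positivity)]
    nlinarith
  set W := ⌊Real.exp t⌋₊ with hWdef
  have hWt : (W : ℝ) ≤ Real.exp t := Nat.floor_le (Real.exp_pos t).le
  have ht3 := Real.add_one_le_exp (t / 2)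
  have hWge : Real.exp (t / 2) ≤ W := by
    have h1 := Nat.lt_floor_add_one (Real.exp t)
    have h2 : Real.exp t = Real.exp (t / 2) * Real.exp (t / 2) := by
      rw [← Real.exp_add]; congr 1; ring
    nlinarith
  have hW2' : (2 : ℝ) ≤ W := by linarith
  have hW2 : 2 ≤ W := by exact_mod_cast hW2'
  have hW1 : (1 : ℝ) ≤ W := by linarith
  have hlW : t / 2 ≤ Real.log W := by
    rw [Real.le_log_iff_exp_le (by linarith)]
    exact hWge
  have htac : t ≤ a / c := by
    rw [htdef]
    gcongr
    nlinarith
  have hlt : Real.log t ≤ b := by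
    rw [← hla]
    exact Real.log_le_log (by linarith) (div_le_self ha0.le hbc2)
  set R := ⌈81 * b⌉₊ with hR
  have hRge : 81 * b ≤ R := Nat.le_ceil _
  have hRle : (R : ℝ) ≤ 82 * b := by
    have := Nat.ceil_lt_add_one (show 0 ≤ 81 * b by positivity)
    linarith
  have hinv : Real.exp (-b) = 1 / a := by rw [Real.exp_neg, hba, one_div]
  -- the truncation error: `log t ≤ b`, so `R ≥ 81 * b` beats the factor `exp (40 * (1 + b))`
  have hε1 : (1 / 4 : ℝ) ^ R * Real.exp (40 * (1 + Real.log t)) ≤ 1 / a := by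
    have h1 : (1 / 4 : ℝ) ≤ Real.exp (-1) := by
      rw [Real.exp_neg, one_div]
      have := Real.exp_one_lt_d9
      exact inv_anti₀ (Real.exp_pos 1) (by linarith)
    calc (1 / 4 : ℝ) ^ R * Real.exp (40 * (1 + Real.log t))
        ≤ (Real.exp (-1)) ^ R * Real.exp (40 * (1 + Real.log t)) := by gcongr
      _ = Real.exp (R * (-1) + 40 * (1 + Real.log t)) := by
          rw [← Real.exp_nat_mul, ← Real.exp_add]
      _ ≤ Real.exp (-b) := Real.exp_le_exp.2 (by linarith)
      _ = 1 / a := hinv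
  -- the remainder: `W ^ (2 * R)` is at most `exp (164 * a / c ^ 2)`, a small power of `exp (a / c)`
  have hε2 : 3 * (W : ℝ) ^ (2 * R) * Y / Real.exp (a / c) ≤ 1 / a := by
    rw [← hinv, div_le_iff₀ (Real.exp_pos _)]
    have h1 : (W : ℝ) ^ (2 * R) ≤ Real.exp (164 * (a / c ^ 2)) := by
      calc (W : ℝ) ^ (2 * R) ≤ Real.exp t ^ (2 * R) := by gcongr
        _ = Real.exp ((2 * R : ℕ) * t) := by rw [Real.exp_nat_mul]
        _ ≤ Real.exp (164 * (a / c ^ 2)) := by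
          apply Real.exp_le_exp.2
          push_cast
          calc 2 * (R : ℝ) * t ≤ 2 * (82 * b) * t := by gcongr
            _ = 164 * (a / c ^ 2) := by rw [htdef]; field_simp; ring
    have h3 : (3 : ℝ) ≤ Real.exp b := by linarith [Real.add_one_le_exp b]
    have h4 : 164 * (a / c ^ 2) ≤ a / c / 2 := by
      have : a / c ^ 2 = a / c / c := by rw [pow_two, div_mul_eq_div_div]
      rw [this, ← mul_div_assoc, div_le_iff₀ hc0]
      have : 0 < a / c := by positivity
      nlinarith
    calc 3 * (W : ℝ) ^ (2 * R) * Y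
        ≤ Real.exp b * Real.exp (164 * (a / c ^ 2)) * Real.exp (18 * b) := by gcongr
      _ = Real.exp (b + 164 * (a / c ^ 2) + 18 * b) := by rw [Real.exp_add, Real.exp_add]
      _ ≤ Real.exp (-b + a / c) := Real.exp_le_exp.2 (by linarith)
      _ = Real.exp (-b) * Real.exp (a / c) := by rw [Real.exp_add]
  refine ⟨W, R, t, by linarith, hW2, hWt, hWt.trans (Real.exp_le_exp.2 htac), ?_⟩
  have h1 : 2 / Real.log W ≤ 4 * (b * c ^ 2) / a := by
    calc 2 / Real.log W ≤ 2 / (t / 2) := by gcongr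
      _ = 4 * (b * c ^ 2) / a := by rw [htdef]; field_simp; norm_num
  have h3 : 1 / a ≤ (b * c ^ 2) / a := by gcongr
  have h4 : 6 * (b * c ^ 2) / a = 4 * (b * c ^ 2) / a + (b * c ^ 2) / a + (b * c ^ 2) / a := by
    ring
  linarith

/-- `card_primePowSqSet_le` for `x = exp a`, with `B` of order `(log x) ^ 5` and `U` of order
`x ^ (1 / (2 * log₃ x))`. -/
theorem card_primePowSqSet_exp_le {a b c : ℝ} (hc : 328 ≤ c) (hba : Real.exp b = a)
    (hb1 : 1000 ≤ b) (habc : 300 * b ≤ a / c) {B U : ℕ} (hB : a ^ 5 ≤ B)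
    (hU : (U : ℝ) ≤ 2 * Real.exp (a / c / 2)) :
    (#(primePowSqSet (Real.exp a) (Real.exp (a / c)) B U) : ℝ) ≤ 15 * Real.exp a / a ^ 2 := by
  have hc0 : 0 < c := by linarith
  have ha0 : 0 < a := hba ▸ Real.exp_pos b
  have he2 : (2 : ℝ) ≤ Real.exp b := by linarith [Real.add_one_le_exp b]
  have ha1 : 1 ≤ a := by linarith
  have hB1 : 1 ≤ B := by
    have : (1 : ℝ) ≤ B := (one_le_pow₀ ha1).trans hB
    exact_mod_cast this
  have h2e : ∀ v, 2 * Real.exp v ≤ Real.exp (b + v) := fun v => by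
    rw [Real.exp_add]; gcongr
  have hacle : a / c ≤ a / 300 := by gcongr; linarith
  have hUx : (U : ℝ) ≤ Real.exp a :=
    hU.trans ((h2e _).trans (Real.exp_le_exp.2 (by linarith)))
  set x := Real.exp a with hx
  set Z := Real.exp (a / c) with hZ
  have hx0 : 0 < x := Real.exp_pos a
  have hZ0 : 0 < Z := Real.exp_pos _
  have hx1 : 1 ≤ x := Real.one_le_exp ha0.le
  have hZ1 : 1 ≤ Z := Real.one_le_exp (by positivity)
  have hlx : Real.log x = a := Real.log_exp a
  have h7 := card_primePowSqSet_le hx1 hZ1 hB1 hUx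
  rw [hlx] at h7
  refine h7.trans ?_
  have h9 : x / B * (1 + a) ≤ 2 * x / a ^ 4 := by
    calc x / B * (1 + a) ≤ x / a ^ 5 * (2 * a) := by gcongr; linarith
      _ = 2 * x / a ^ 4 := by field_simp
  have h10 : U * (x / Z) ≤ x / a ^ 4 := by
    have h11 : (U : ℝ) * a ^ 4 ≤ Z := by
      calc (U : ℝ) * a ^ 4 ≤ Real.exp (b + a / c / 2) * a ^ 4 := by
            gcongr
            exact hU.trans (h2e _)
        _ = Real.exp (b + a / c / 2 + (4 : ℕ) * b) := by
            rw [Real.exp_add _ ((4 : ℕ) * b), Real.exp_nat_mul, hba]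
        _ ≤ Z := Real.exp_le_exp.2 (by push_cast; linarith)
    rw [← mul_div_assoc, div_le_div_iff₀ hZ0 (by positivity)]
    calc U * x * a ^ 4 = x * (U * a ^ 4) := by ring
      _ ≤ x * Z := by gcongr
  calc 5 * a * (x / B * (1 + a) + U * (x / Z)) ≤ 5 * a * (2 * x / a ^ 4 + x / a ^ 4) := by
        gcongr
    _ = 15 * x / a ^ 2 / a := by field_simp; norm_num
    _ ≤ 15 * x / a ^ 2 := div_le_self (by positivity) ha1

/-- The second moment bound in quantitative form, with `a`, `b`, `c` the first three iterated
logarithms of `x`; the threshold `328` ensures `164 / c ≤ 1 / 2` in the sieve remainder. -/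
theorem exists_sum_largePrimeSet_le : ∃ K : ℝ, ∀ x a b c : ℝ, 328 ≤ c → Real.exp c = b →
    Real.exp b = a → Real.exp a = x →
    ∑ n ∈ largePrimeSet x (Real.exp (a / c)), ((Ω (s n) : ℝ) - ω (s n)) ^ 2 ≤
      K * (x * (b * c ^ 4)) := by
  obtain ⟨C, hC0, hC⟩ := exists_sum_properPrimePowers_le
  refine ⟨128 + 2 * (12 * (40 * C) ^ 2) + 135, ?_⟩
  intro x a b c hc hcb hba hax
  have hc0 : 0 < c := by linarith
  have hb : 1000 * c ^ 2 ≤ b := hcb ▸ mul_sq_le_exp hc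
  have hb1 : 1000 ≤ b := by nlinarith
  have hb0 : 0 < b := by linarith
  have ha : 1000 * b ^ 2 ≤ a := hba ▸ mul_sq_le_exp (by linarith)
  have ha0 : 0 < a := hba ▸ Real.exp_pos b
  have hx0 : 0 < x := hax ▸ Real.exp_pos a
  have hcb' : c ≤ b := by nlinarith
  have habc : 300 * b ≤ a / c := by
    rw [le_div_iff₀ hc0]
    nlinarith
  have ha1 : 1000 ≤ a := by linarith [Real.add_one_le_exp b]
  have hx1 : 1 ≤ x := by rw [← hax]; exact Real.one_le_exp ha0.le
  have hlx : Real.log x = a := by rw [← hax, Real.log_exp]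
  have hlb : Real.log b = c := by rw [← hcb, Real.log_exp]
  have he2 : (2 : ℝ) ≤ Real.exp b := by linarith
  have hac0 : 0 < a / c := by positivity
  have hu1 : 1 < Real.exp (a / c / 4) := Real.one_lt_exp_iff.2 (by positivity)
  -- with `a = log x` and `Z = exp (a / c)`: the split between small and large primes is at
  -- `u = Z ^ (1 / 4)`, and `U ≈ Z ^ (1 / 2)` leaves room for `u * B ≤ U`
  set B := ⌈a ^ 5⌉₊ with hBdef
  have hBge : a ^ 5 ≤ B := Nat.le_ceil _
  have ha5 : 1 ≤ a ^ 5 := one_le_pow₀ (by linarith)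
  have hB1 : 1 ≤ B := by
    have : (1 : ℝ) ≤ B := by linarith
    exact_mod_cast this
  have hB6 : (B : ℝ) ≤ Real.exp (6 * b) := by
    have e : Real.exp (6 * b) = Real.exp b * a ^ 5 := by
      rw [← hba, ← Real.exp_nat_mul, ← Real.exp_add]; congr 1; push_cast; ring
    have h1 := Nat.ceil_lt_add_one (show 0 ≤ a ^ 5 by positivity)
    have h2 : (2 : ℝ) * a ^ 5 ≤ Real.exp b * a ^ 5 := by gcongr
    rw [e]
    linarith
  set U := ⌈Real.exp (a / c / 2)⌉₊ with hUdef
  have hUge : Real.exp (a / c / 2) ≤ U := Nat.le_ceil _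
  have hUle : (U : ℝ) ≤ 2 * Real.exp (a / c / 2) := by
    have h1 := Nat.ceil_lt_add_one (show 0 ≤ Real.exp (a / c / 2) by positivity)
    have h2 : 1 ≤ Real.exp (a / c / 2) := Real.one_le_exp (by positivity)
    linarith
  have huB : Real.exp (a / c / 4) * B ≤ U := by
    refine le_trans ?_ hUge
    calc Real.exp (a / c / 4) * B ≤ Real.exp (a / c / 4) * Real.exp (6 * b) := by gcongr
      _ = Real.exp (a / c / 4 + 6 * b) := by rw [Real.exp_add]
      _ ≤ Real.exp (a / c / 2) := Real.exp_le_exp.2 (by linarith)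
  have hY : ((B ^ 3 : ℕ) : ℝ) ≤ Real.exp (18 * b) := by
    push_cast
    calc (B : ℝ) ^ 3 ≤ Real.exp (6 * b) ^ 3 := by gcongr
      _ = Real.exp (18 * b) := by rw [← Real.exp_nat_mul]; congr 1; push_cast; ring
  obtain ⟨W, R, t, ht, hW2, hWt, hWZ, hH⟩ := exists_sieve_parameters hc hcb hba hY
  set G := 6 * (b * c ^ 2) / a * x * (1 + Real.log x) with hG
  have hG0 : 0 ≤ G := by rw [hG, hlx]; positivity
  have hGle : G ≤ 12 * (x * (b * c ^ 2)) := by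
    calc G = 6 * (b * c ^ 2) / a * x * (1 + a) := by rw [hG, hlx]
      _ ≤ 6 * (b * c ^ 2) / a * x * (2 * a) := by gcongr; linarith
      _ = 12 * (x * (b * c ^ 2)) := by field_simp; norm_num
  have hsum := sum_sq_cardFactors_sub_le (x := x) (Z := Real.exp (a / c)) (G := G) hx1 hu1 hB1
    huB hG0 (fun p k hpk => by
      obtain ⟨hp, -, hkY⟩ := mem_properPrimePowers.1 hpk
      exact card_largePrimeSet_primePow_le hx1 (Real.one_le_exp hac0.le) hp hkY ht hW2 hWt hWZ hH)
  refine hsum.trans ?_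
  have hc2 : 1 ≤ c ^ 2 := one_le_pow₀ (by linarith)
  have hc4 : c ^ 2 ≤ b * c ^ 4 := by
    have h1 : 1 ≤ b * c ^ 2 := one_le_mul_of_one_le_of_one_le (by linarith) hc2
    calc c ^ 2 = 1 * c ^ 2 := by ring
      _ ≤ b * c ^ 2 * c ^ 2 := by gcongr
      _ = b * c ^ 4 := by ring
  have h1 : x * (2 * (2 * Real.log x / Real.log (Real.exp (a / c / 4))) ^ 2) ≤
      128 * (x * (b * c ^ 4)) := by
    have e : 2 * Real.log x / Real.log (Real.exp (a / c / 4)) = 8 * c := by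
      rw [Real.log_exp, hlx]; field_simp; norm_num
    rw [e]
    calc x * (2 * (8 * c) ^ 2) = 128 * (x * c ^ 2) := by ring
      _ ≤ 128 * (x * (b * c ^ 4)) := by gcongr
  have h2 : 2 * (G * (∑ pk ∈ properPrimePowers (B ^ 3),
      ((pk.2 : ℝ) + 1) * (1 / √(pk.1 : ℝ)) ^ pk.2) ^ 2) ≤
      2 * (12 * (40 * C) ^ 2) * (x * (b * c ^ 4)) := by
    have h3 := sum_inv_primesBelow_le (t := 18 * b) (by linarith) hY
    have h4 : Real.log (18 * b) ≤ 17 + c := by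
      rw [Real.log_mul (by norm_num) hb0.ne', hlb]
      have := Real.log_le_sub_one_of_pos (show (0 : ℝ) < 18 by norm_num)
      linarith
    have h5 : ∑ pk ∈ properPrimePowers (B ^ 3),
        ((pk.2 : ℝ) + 1) * (1 / √(pk.1 : ℝ)) ^ pk.2 ≤ 40 * C * c := by
      refine (hC (B ^ 3)).trans ?_
      calc C * ∑ p ∈ Nat.primesBelow (B ^ 3 + 1), (1 / p : ℝ) ≤ C * (40 * c) :=
            mul_le_mul_of_nonneg_left (by linarith) hC0.le
        _ = 40 * C * c := by ring
    have h50 : 0 ≤ ∑ pk ∈ properPrimePowers (B ^ 3),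
        ((pk.2 : ℝ) + 1) * (1 / √(pk.1 : ℝ)) ^ pk.2 := sum_nonneg fun _ _ => by positivity
    calc 2 * (G * (∑ pk ∈ properPrimePowers (B ^ 3),
        ((pk.2 : ℝ) + 1) * (1 / √(pk.1 : ℝ)) ^ pk.2) ^ 2)
        ≤ 2 * (12 * (x * (b * c ^ 2)) * (40 * C * c) ^ 2) := by gcongr
      _ = 2 * (12 * (40 * C) ^ 2) * (x * (b * c ^ 4)) := by ring
  have h6 : (#(primePowSqSet x (Real.exp (a / c)) B U) : ℝ) *
      (2 * Real.log x / Real.log 2) ^ 2 ≤ 135 * (x * (b * c ^ 4)) := by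
    have h8 := card_primePowSqSet_exp_le hc hba hb1 habc hBge hUle
    rw [hax] at h8
    have hl2 := Real.log_two_gt_d9
    have h12 : 2 * a / Real.log 2 ≤ 3 * a := by
      rw [div_le_iff₀ (by linarith)]
      have := mul_le_mul_of_nonneg_left hl2.le (show 0 ≤ 3 * a by positivity)
      linarith only [this, ha0]
    have h13 : 0 ≤ 2 * a / Real.log 2 := by positivity
    rw [hlx]
    calc (#(primePowSqSet x (Real.exp (a / c)) B U) : ℝ) * (2 * a / Real.log 2) ^ 2
        ≤ 15 * x / a ^ 2 * (3 * a) ^ 2 := by gcongr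
      _ = 135 * (x * 1) := by field_simp; norm_num
      _ ≤ 135 * (x * (b * c ^ 4)) := by gcongr; exact hc2.trans hc4
  linarith only [h1, h2, h6]

theorem sdiff_exceptionalSet_subset (x : ℝ) :
    Icc 1 ⌊x⌋₊ \ exceptionalSet x ⊆ largePrimeSet x (x ^ (1 / logIter 3 x)) := by
  classical
  intro n hn
  rw [mem_sdiff, exceptionalSet, mem_filter, not_and, not_not] at hn
  have hreg := hn.2 hn.1
  have h1 := mem_Icc.1 hn.1
  exact mem_largePrimeSet.2 ⟨⟨h1.1, h1.2⟩, hreg.condA, hreg.condB⟩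

end Aliquot

theorem lemma5p1 :
    (fun x : ℝ => ∑ n ∈ Finset.Icc 1 ⌊x⌋₊ \ Aliquot.exceptionalSet x,
        ((Ω (Aliquot.s n) : ℝ) - (ω (Aliquot.s n) : ℝ)) ^ 2)
      =o[Filter.atTop] (fun x : ℝ => x * (Aliquot.logIter 2 x) ^ 2) := by
  obtain ⟨K, hK⟩ := Aliquot.exists_sum_largePrimeSet_le
  have hlog3 : Filter.Tendsto (fun x : ℝ => Real.log (Real.log (Real.log x)))
      Filter.atTop Filter.atTop :=
    Real.tendsto_log_atTop.comp (Real.tendsto_log_atTop.comp Real.tendsto_log_atTop)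
  have hlog2 : Filter.Tendsto (fun x : ℝ => Real.log (Real.log x)) Filter.atTop Filter.atTop :=
    Real.tendsto_log_atTop.comp Real.tendsto_log_atTop
  have hsmall : (fun x : ℝ => x * (Real.log (Real.log x) *
      Real.log (Real.log (Real.log x)) ^ 4)) =o[Filter.atTop]
      (fun x : ℝ => x * (Real.log (Real.log x)) ^ 2) := by
    have h1 := (Real.isLittleO_pow_log_id_atTop (n := 4)).comp_tendsto hlog2
    have h2 := ((Asymptotics.isBigO_refl (fun x : ℝ => x * Real.log (Real.log x))
      Filter.atTop).mul_isLittleO h1)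
    refine h2.congr (fun x => ?_) (fun x => ?_)
    · simp only [Function.comp]; ring
    · simp only [Function.comp, id]; ring
  have heq : (fun x : ℝ => x * (Aliquot.logIter 2 x) ^ 2) =ᶠ[Filter.atTop]
      (fun x : ℝ => x * (Real.log (Real.log x)) ^ 2) := by
    filter_upwards [Real.tendsto_log_atTop.eventually_ge_atTop 1,
      hlog2.eventually_ge_atTop 1] with x h1 h2
    simp only [Aliquot.logIter, Function.iterate_succ, Function.iterate_zero, Function.comp, id]
    rw [max_eq_right h1, max_eq_right h2]
  refine Asymptotics.IsBigO.trans_isLittleO ?_ (hsmall.trans_eventuallyEq heq.symm)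
  refine Asymptotics.IsBigO.of_bound K ?_
  filter_upwards [Real.tendsto_log_atTop.eventually_ge_atTop 1, hlog2.eventually_ge_atTop 1,
    hlog3.eventually_ge_atTop 328, Filter.eventually_gt_atTop 0] with x h1 h2 h3 hx
  have hb0 : 0 < Real.log (Real.log x) := by linarith
  have ha0 : 0 < Real.log x := by linarith
  have h4 : Aliquot.logIter 3 x = Real.log (Real.log (Real.log x)) := by
    simp only [Aliquot.logIter, Function.iterate_succ, Function.iterate_zero, Function.comp, id]
    rw [max_eq_right h1, max_eq_right h2, max_eq_right (by linarith)]
  have h5 := Aliquot.sdiff_exceptionalSet_subset x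
  have h6 := hK x (Real.log x) (Real.log (Real.log x)) _ h3 (Real.exp_log hb0)
    (Real.exp_log ha0) (Real.exp_log hx)
  have h7 : x ^ (1 / Aliquot.logIter 3 x) =
      Real.exp (Real.log x / Real.log (Real.log (Real.log x))) := by
    rw [Real.rpow_def_of_pos hx, h4, mul_one_div]
  rw [h7] at h5
  have h8 := Finset.sum_le_sum_of_subset_of_nonneg h5
    (f := fun n => ((Ω (Aliquot.s n) : ℝ) - (ω (Aliquot.s n) : ℝ)) ^ 2)
    fun _ _ _ => sq_nonneg _
  rw [Real.norm_of_nonneg (Finset.sum_nonneg fun _ _ => sq_nonneg _),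
    Real.norm_of_nonneg (by positivity)]
  exact h8.trans h6
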